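/- For a nonnegative integer $k$ put $(x;q)_k=\prod_{i=0}^{k-1}(1-xq^i)$, for a nonnegative integer $r$ let $[r]=(1-q^r)/(1-q)$, and let $\Phi_n(q)$ be the $n$-th cyclotomic polynomial, where $q$ is an indeterminate. For rational functions $A,B\in\mathbb{Q}(q)$ and a nonzero polynomial $P\in\mathbb{Q}[q]$, write $A\equiv B\pmod P$ if $P$ divides the numerator of $A-B$ written in lowest terms. Theorem. Let $n$ be a positive integer with $n\equiv 2\pmod 3$, and let $M=(2n-1)/3$ or $M=n-1$. Then $$\sum_{k=0}^{M}[6k+1]\frac{(q;q^3)_k^6}{(q^3;q^3)_k^6}\,q^{3k}\equiv 5\,[2n]\,\frac{(q^2;q^3)_{(2n-1)/3}^3}{(q^3;q^3)_{(2n-1)/3}^3}\pmod{[n]\,\Phi_n(q)^5}.$$ -/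

import Mathlib

/-- The `q`-shifted factorial `(x; q)_n = (1 - x)(1 - x q) ⋯ (1 - x q ^ (n - 1))`. -/
def qShifted {K : Type*} [Field K] (x q : K) (n : ℕ) : K :=
  ∏ i ∈ Finset.range n, (1 - x * q ^ i)

/-- The `q`-integer `[r] = (1 - q ^ r) / (1 - q)`. -/
def qInteger {K : Type*} [Field K] (q : K) (r : ℕ) : K :=
  (1 - q ^ r) / (1 - q)

/-- The `q`-integer `[n]` in the indeterminate `q`, as the polynomial
`1 + q + ⋯ + q ^ (n - 1)`. -/
noncomputable def qIntegerPoly (n : ℕ) : Polynomial ℚ :=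
  ∑ i ∈ Finset.range n, (Polynomial.X : Polynomial ℚ) ^ i

/-- The polynomial `qIntegerPoly n` is the rational function `(1 - q ^ n) / (1 - q)`. -/
theorem qIntegerPoly_eq_qInteger (n : ℕ) :
    algebraMap (Polynomial ℚ) (RatFunc ℚ) (qIntegerPoly n) =
      qInteger (RatFunc.X : RatFunc ℚ) n := by
  have hX : (RatFunc.X : RatFunc ℚ) ≠ 1 := by
    intro h
    rw [← RatFunc.algebraMap_X, ← map_one (algebraMap (Polynomial ℚ) (RatFunc ℚ))] at h
    exact Polynomial.X_ne_C (1 : ℚ) (by simpa using RatFunc.algebraMap_injective ℚ h)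
  have hX' : (1 : RatFunc ℚ) - RatFunc.X ≠ 0 := sub_ne_zero.mpr hX.symm
  rw [qIntegerPoly, qInteger, map_sum, eq_div_iff hX']
  simp only [map_pow, RatFunc.algebraMap_X]
  exact geom_sum_mul_neg _ _

/-- Congruence of rational functions in `q` modulo a polynomial `P`: written in lowest terms,
`A - B` has a numerator divisible by `P` (so its denominator is coprime to `P`). -/
def QCongr (P : Polynomial ℚ) (A B : RatFunc ℚ) : Prop :=
  P ∣ (A - B).num

/-!
Let `ζ` be a primitive `n`-th root of unity and `w` a primitive fifth root of unity. Deform `q` to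
`ζ eˢ` and the six parameters of the very-well-poised sum to `q x_j`, where `x_0 = 1` and the other
five `x_j` are `exp (wʲ t)`, and call the sum `F(s, t)`. As `∏ x_j = 1`, `F` vanishes at `s = 0` by
the antisymmetry `k ↦ m - k`, and it is invariant under `t ↦ w t`; hence `F(s, t) - F(s, 0)` is
divisible by `s t⁵`, and on a line `t = c s` it is `O(s⁶)`. On the line `t = -2 n s` one parameter
becomes `q ^ (1 - 2 n) = (q³) ^ (-m)`, where `m = (2 n - 1) / 3`, and Jackson's summation evaluates
`F` as a product, whose two leading terms are all that matters modulo `s⁶`. The factor `5` is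
`(1 + 2 (w + w²)) (1 + 2 (w + w³)) (1 + 2 (w² + w³))`.

For a divisor `1 < d < n` of `n` the sum splits modulo `Φ_d` into blocks of length `d`, each of
which vanishes by the same antisymmetry, and `[n] Φ_n ^ 5` is `Φ_n ^ 6` times the product of these
`Φ_d`.
-/

open Finset

section Jackson

variable {F : Type*} [Field F]

theorem wellPoised_identity (a b c d E f K : F) (ha : a ≠ 0) (hb : b ≠ 0) (hc : c ≠ 0) (hd : d ≠ 0)
    (hf : f ≠ 0) (h : b * c * d * E * f = a ^ 2) :
    (E - f) * ((1 - a * K) * (1 - b * K) * (1 - c * K) * (1 - d * K) * ((1 - E * K) * (1 - f * K))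
      - (1 - K) * (1 - a * K / b) * (1 - a * K / c) * (1 - a * K / d) * ((1 - a * K / E) *
        (1 - a * K / f))) =
    K * (1 - a * K ^ 2) *
      (f * (f - 1) * ((1 - a / (b * f)) * (1 - a / (c * f)) * (1 - a / (d * f))) *
          ((1 - E * K) * (1 - a * K / E)) -
        E * (E - 1) * ((1 - a / (b * E)) * (1 - a / (c * E)) * (1 - a / (d * E))) *
          ((1 - f * K) * (1 - a * K / f))) := by
  obtain rfl : E = a ^ 2 / (b * c * d * f) := by field_simp; linear_combination h
  field_simp
  ring

theorem wellPoised_identity_initial (a b c d E f : F) (ha : a ≠ 0) (hb : b ≠ 0) (hc : c ≠ 0)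
    (hd : d ≠ 0) (hf : f ≠ 0) (h : b * c * d * E * f = a ^ 2) :
    (E - f) * ((1 - b) * (1 - c) * (1 - d)) =
      E * ((1 - a / (b * E)) * (1 - a / (c * E)) * (1 - a / (d * E))) * (1 - a / f) -
      f * ((1 - a / (b * f)) * (1 - a / (c * f)) * (1 - a / (d * f))) * (1 - a / E) := by
  obtain rfl : E = a ^ 2 / (b * c * d * f) := by field_simp; linear_combination h
  field_simp
  ring

/-- The `i`-th factor of a well-poised term with base `Q` contributed by the parameter `u`. -/
def wpFactor (a Q u : F) (i : ℕ) : F := (1 - u * Q ^ i) / (1 - a * Q ^ (i + 1) / u)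

/-- The part of the `i`-th factor of a well-poised term that two contiguous series share. -/
def wpFactors (a b c d Q : F) (i : ℕ) : F :=
  wpFactor a Q a i * wpFactor a Q b i * wpFactor a Q c i * wpFactor a Q d i

theorem wpFactors_mul {a b c d Q : F} {k : ℕ} (ha : a ≠ 0) (hQk : 1 - Q ^ (k + 1) ≠ 0)
    (hbk : 1 - a * Q ^ (k + 1) / b ≠ 0) (hck : 1 - a * Q ^ (k + 1) / c ≠ 0)
    (hdk : 1 - a * Q ^ (k + 1) / d ≠ 0) :
    wpFactors a b c d Q k * ((1 - Q ^ (k + 1)) * (1 - a * Q ^ (k + 1) / b) *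
        (1 - a * Q ^ (k + 1) / c) * (1 - a * Q ^ (k + 1) / d)) =
      (1 - a * Q ^ k) * (1 - b * Q ^ k) * (1 - c * Q ^ k) * (1 - d * Q ^ k) := by
  simp only [wpFactors, wpFactor, mul_div_cancel_left₀ _ ha, div_mul_div_comm]
  exact div_mul_cancel₀ _ (mul_ne_zero (mul_ne_zero (mul_ne_zero hQk hbk) hck) hdk)

/-- The `k`-th term of the very-well-poised series with base `Q` and parameters
`a; b, c, d, e, f`, without the normalization `1 / (1 - a)`. -/
def wpTerm (a b c d e f Q : F) (k : ℕ) : F :=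
  (1 - a * (Q ^ k) ^ 2) * Q ^ k *
    ∏ i ∈ range k, (wpFactors a b c d Q i * (wpFactor a Q e i * wpFactor a Q f i))

theorem wpTerm_comm (a b c d e f Q : F) (k : ℕ) :
    wpTerm a b c d e f Q k = wpTerm a b c d f e Q k := by
  simp only [wpTerm, mul_comm (wpFactor a Q e _)]

/-- The common part of the `(k + 1)`-st terms of the contiguous series with last parameters
`E * Q, f` and `E, f * Q`. -/
def wpCommon (a b c d E f Q : F) (k : ℕ) : F :=
  (∏ i ∈ range k, (wpFactors a b c d Q i * ((1 - E * Q ^ (i + 1)) * (1 - f * Q ^ (i + 1))))) /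
    ∏ i ∈ range (k + 1), ((1 - a * Q ^ i / E) * (1 - a * Q ^ i / f))

theorem wpCommon_comm (a b c d E f Q : F) (k : ℕ) :
    wpCommon a b c d E f Q k = wpCommon a b c d f E Q k := by
  simp only [wpCommon, mul_comm (1 - E * Q ^ (_ + 1)), mul_comm (1 - a * Q ^ _ / E)]

theorem wpCommon_succ (a b c d E f Q : F) (k : ℕ) :
    wpCommon a b c d E f Q (k + 1) = wpCommon a b c d E f Q k * wpFactors a b c d Q k *
      ((1 - E * Q ^ (k + 1)) * (1 - f * Q ^ (k + 1)) /
        ((1 - a * Q ^ (k + 1) / E) * (1 - a * Q ^ (k + 1) / f))) := by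
  simp only [wpCommon, prod_range_succ _ (k + 1), prod_range_succ _ k, div_eq_mul_inv, mul_inv]
  ring

theorem wpTerm_succ (a b c d E f Q : F) (hQ : Q ≠ 0) (hE : E ≠ 0) (hf : 1 - a / f ≠ 0) (k : ℕ) :
    wpTerm a b c d (E * Q) f Q (k + 1) =
      (1 - a * (Q ^ (k + 1)) ^ 2) * Q ^ (k + 1) *
        (wpCommon a b c d E f Q k * wpFactors a b c d Q k) *
        ((1 - E * Q ^ (k + 1)) * ((1 - f) * (1 - a / f)) / (1 - a * Q ^ (k + 1) / f)) := by
  have hfactor (i : ℕ) : wpFactor a Q (E * Q) i = (1 - E * Q ^ (i + 1)) / (1 - a * Q ^ i / E) := by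
    rw [wpFactor, show a * Q ^ (i + 1) / (E * Q) = a * Q ^ i / E by field_simp; ring,
      mul_assoc, ← pow_succ']
  have hnum : ∏ i ∈ range (k + 1), (1 - f * Q ^ i) =
      (∏ i ∈ range k, (1 - f * Q ^ (i + 1))) * (1 - f) := by
    rw [prod_range_succ', pow_zero, mul_one]
  have hden : (∏ i ∈ range (k + 1), (1 - a * Q ^ (i + 1) / f)) * (1 - a / f) =
      (∏ i ∈ range (k + 1), (1 - a * Q ^ i / f)) * (1 - a * Q ^ (k + 1) / f) := by
    rw [← prod_range_succ (fun i => 1 - a * Q ^ i / f), prod_range_succ' _ (k + 1), pow_zero,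
      mul_one]
  rw [← eq_div_iff hf] at hden
  simp only [wpTerm, wpCommon, hfactor, wpFactor.eq_1 a Q f, prod_mul_distrib, prod_div_distrib,
    hnum, hden, prod_range_succ (fun i => 1 - E * Q ^ (i + 1)),
    prod_range_succ (wpFactors a b c d Q)]
  simp only [div_eq_mul_inv, mul_inv, inv_inv]
  ring

/-- Zeilberger-style telescoping: `α` and `β` are chosen so that the difference of the two
contiguous terms is a forward difference. -/
theorem sum_wpTerm_contiguous (a b c d E f Q α β : F) (ha : a ≠ 0) (hb : b ≠ 0) (hc : c ≠ 0)
    (hd : d ≠ 0) (hE : E ≠ 0) (hf : f ≠ 0) (hQ : Q ≠ 0) (h : b * c * d * E * f = a ^ 2)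
    (hα : α * (1 - a / f) = -f * ((1 - a / (b * f)) * (1 - a / (c * f)) * (1 - a / (d * f))))
    (hβ : β * (1 - a / E) = -E * ((1 - a / (b * E)) * (1 - a / (c * E)) * (1 - a / (d * E))))
    (k : ℕ) (hQi : ∀ i < k, 1 - Q ^ (i + 1) ≠ 0) (hbi : ∀ i < k, 1 - a * Q ^ (i + 1) / b ≠ 0)
    (hci : ∀ i < k, 1 - a * Q ^ (i + 1) / c ≠ 0) (hdi : ∀ i < k, 1 - a * Q ^ (i + 1) / d ≠ 0)
    (hEi : ∀ i ≤ k, 1 - a * Q ^ i / E ≠ 0) (hfi : ∀ i ≤ k, 1 - a * Q ^ i / f ≠ 0) :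
    ∑ j ∈ range (k + 1), (α * wpTerm a b c d (E * Q) f Q j - β * wpTerm a b c d E (f * Q) Q j) =
      (E - f) * ((1 - a * Q ^ k) * (1 - b * Q ^ k) * (1 - c * Q ^ k) * (1 - d * Q ^ k)) *
        wpCommon a b c d E f Q k := by
  have hE0 : 1 - a / E ≠ 0 := by simpa using hEi 0 (Nat.zero_le _)
  have hf0 : 1 - a / f ≠ 0 := by simpa using hfi 0 (Nat.zero_le _)
  induction k with
  | zero =>
    simp only [zero_add, sum_range_one, wpTerm, wpCommon, pow_zero, range_zero, prod_empty, mul_one,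
      one_pow, prod_range_one]
    rw [mul_one_div, eq_div_iff (mul_ne_zero hE0 hf0)]
    linear_combination (1 - a) * ((1 - a / E) * hα - (1 - a / f) * hβ -
      wellPoised_identity_initial a b c d E f ha hb hc hd hf h)
  | succ k ih =>
    have hidentity := wellPoised_identity a b c d E f (Q ^ (k + 1)) ha hb hc hd hf h
    rw [sum_range_succ, ih (fun i hi => hQi i (by lia)) (fun i hi => hbi i (by lia))
      (fun i hi => hci i (by lia)) (fun i hi => hdi i (by lia)) (fun i hi => hEi i (by lia))
      (fun i hi => hfi i (by lia)), ← wpFactors_mul ha (hQi k k.lt_succ_self)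
      (hbi k k.lt_succ_self) (hci k k.lt_succ_self) (hdi k k.lt_succ_self), wpCommon_succ,
      wpTerm_succ a b c d E f Q hQ hE hf0, wpTerm_comm, wpTerm_succ a b c d f E Q hQ hf hE0,
      wpCommon_comm a b c d f E]
    have hEk := hEi (k + 1) le_rfl
    have hfk := hfi (k + 1) le_rfl
    generalize 1 - a * Q ^ (k + 1) / E = DE at *
    generalize 1 - a * Q ^ (k + 1) / f = DF at *
    generalize 1 - a / E = DE₀ at *
    generalize 1 - a / f = DF₀ at *
    generalize 1 - a * Q ^ (k + 1) / b = Db at *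
    generalize 1 - a * Q ^ (k + 1) / c = Dc at *
    generalize 1 - a * Q ^ (k + 1) / d = Dd at *
    field_simp
    linear_combination (wpCommon a b c d E f Q k * wpFactors a b c d Q k) *
      (Q ^ (k + 1) * (1 - a * (Q ^ (k + 1)) ^ 2) *
        ((1 - E * Q ^ (k + 1)) * (1 - f) * DE * hα - (1 - f * Q ^ (k + 1)) * (1 - E) * DF * hβ) -
      hidentity)

theorem eq_div_of_balanced {a b c d E f y : F} (hb : b ≠ 0) (hc : c ≠ 0) (hd : d ≠ 0)
    (hf : f * y = 1) (h : b * c * d * E * f = a ^ 2) : E = a ^ 2 * y / (b * c * d) := by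
  rw [eq_div_iff (mul_ne_zero (mul_ne_zero hb hc) hd)]
  linear_combination y * h - b * c * d * E * hf

theorem one_sub_div_ne_zero_reflect {a b c d Q : F} {i N : ℕ} (ha : a ≠ 0) (hb : b ≠ 0)
    (hc : c ≠ 0) (hd : d ≠ 0) (hQ : Q ≠ 0) (hi : i ≤ N)
    (h : 1 - a * Q ^ (N - i) / (b * c * d) ≠ 0) :
    1 - a * Q ^ i / (a ^ 2 * Q ^ N / (b * c * d)) ≠ 0 := by
  rw [← pow_sub_mul_pow Q hi]
  contrapose! h
  field_simp at h ⊢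
  linear_combination -h

theorem jackson_recurrence (a b c d E f Q y : F) (ha : a ≠ 0) (hb : b ≠ 0) (hc : c ≠ 0)
    (hd : d ≠ 0) (hQ : Q ≠ 0) (n : ℕ) (hy : y = Q ^ (n + 1)) (hf : f * y = 1)
    (h : b * c * d * E * f = a ^ 2)
    (hQi : ∀ i < n + 1, 1 - Q ^ (i + 1) ≠ 0) (hbi : ∀ i < n + 1, 1 - a * Q ^ (i + 1) / b ≠ 0)
    (hci : ∀ i < n + 1, 1 - a * Q ^ (i + 1) / c ≠ 0)
    (hdi : ∀ i < n + 1, 1 - a * Q ^ (i + 1) / d ≠ 0)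
    (hai : ∀ i < 2 * (n + 1), 1 - a * Q ^ (i + 1) ≠ 0)
    (hbcd : ∀ i ≤ n + 1, 1 - a * Q ^ i / (b * c * d) ≠ 0) :
    (∑ k ∈ range (n + 2), wpTerm a b c d (E * Q) f Q k) *
        ((1 - a * y / b) * (1 - a * y / c) * (1 - a * y / d) * (1 - a * y / (b * c * d))) =
      (∑ k ∈ range (n + 1), wpTerm a b c d E (f * Q) Q k) *
        ((1 - a * y) * ((1 - a * y / (b * c)) * (1 - a * y / (b * d)) *
          (1 - a * y / (c * d)))) := by
  have hf0 : f ≠ 0 := left_ne_zero_of_mul_eq_one hf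
  have hy0 : y ≠ 0 := right_ne_zero_of_mul_eq_one hf
  have hfy : f = y⁻¹ := eq_inv_of_mul_eq_one_left hf
  have hE : E = a ^ 2 * y / (b * c * d) := eq_div_of_balanced hb hc hd hf h
  have hE0 : E ≠ 0 := by rintro rfl; exact pow_ne_zero 2 ha (by simpa using h.symm)
  have hdivf (u : F) : a / (u * f) = a * y / u := by rw [hfy]; field_simp
  have hfi (i : ℕ) (hi : i ≤ n + 1) : 1 - a * Q ^ i / f ≠ 0 := by
    rw [hfy, div_inv_eq_mul, mul_assoc, hy, ← pow_add]
    exact hai (i + n) (by lia)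
  have hEi (i : ℕ) (hi : i ≤ n + 1) : 1 - a * Q ^ i / E ≠ 0 := by
    rw [hE, hy]
    exact one_sub_div_ne_zero_reflect ha hb hc hd hQ hi (hbcd (n + 1 - i) (by lia))
  have hay : 1 - a * y ≠ 0 := hy ▸ hai n (by lia)
  have habcd : 1 - a * y / (b * c * d) ≠ 0 := hy ▸ hbcd (n + 1) le_rfl
  have htelescope := sum_wpTerm_contiguous a b c d E f Q
    (-f * ((1 - a * y / b) * (1 - a * y / c) * (1 - a * y / d)) / (1 - a * y))
    (-f * ((1 - a * y / (b * c)) * (1 - a * y / (b * d)) * (1 - a * y / (c * d))) /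
      (1 - a * y / (b * c * d))) ha hb hc hd hE0 hf0 hQ h
    (by rw [hdivf, hdivf, hdivf, hfy, div_inv_eq_mul, div_mul_cancel₀ _ hay])
    (by
      rw [div_mul_eq_mul_div, div_eq_iff habcd, hE, hfy]
      field_simp
      ring)
    (n + 1) hQi hbi hci hdi hEi hfi
  have hcommon : wpCommon a b c d E f Q (n + 1) = 0 := by
    simp [wpCommon, prod_range_succ _ n, ← hy, hf]
  have hlast : wpTerm a b c d E (f * Q) Q (n + 1) = 0 := by
    simp [wpTerm, prod_range_succ _ n, wpFactor, mul_assoc, ← pow_succ', ← hy, hf]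
  rw [hcommon, mul_zero, sum_sub_distrib, ← mul_sum, ← mul_sum,
    sum_range_succ (wpTerm a b c d E (f * Q) Q), hlast, add_zero, sub_eq_zero] at htelescope
  generalize 1 - a * y / (b * c * d) = Dbcd at *
  generalize 1 - a * y = Da at *
  field_simp at htelescope ⊢
  linear_combination -htelescope

/-- **Jackson's sum** for a terminating balanced very-well-poised `8φ7` series. -/
theorem jackson_sum (a b c d Q : F) (ha : a ≠ 0) (hb : b ≠ 0) (hc : c ≠ 0) (hd : d ≠ 0)
    (hQ : Q ≠ 0) (n : ℕ) (hQi : ∀ i < n, 1 - Q ^ (i + 1) ≠ 0)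
    (hbi : ∀ i < n, 1 - a * Q ^ (i + 1) / b ≠ 0) (hci : ∀ i < n, 1 - a * Q ^ (i + 1) / c ≠ 0)
    (hdi : ∀ i < n, 1 - a * Q ^ (i + 1) / d ≠ 0) (hai : ∀ i < 2 * n, 1 - a * Q ^ (i + 1) ≠ 0)
    (hbcd : ∀ i ≤ n, 1 - a * Q ^ i / (b * c * d) ≠ 0) (e f : F) (hf : f * Q ^ n = 1)
    (h : b * c * d * e * f = a ^ 2 * Q) :
    (∑ k ∈ range (n + 1), wpTerm a b c d e f Q k) * ∏ i ∈ range n,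
        ((1 - a * Q ^ (i + 1) / b) * (1 - a * Q ^ (i + 1) / c) * (1 - a * Q ^ (i + 1) / d) *
          (1 - a * Q ^ (i + 1) / (b * c * d))) =
      (1 - a) * ∏ i ∈ range n,
        ((1 - a * Q ^ (i + 1)) * ((1 - a * Q ^ (i + 1) / (b * c)) *
          (1 - a * Q ^ (i + 1) / (b * d)) * (1 - a * Q ^ (i + 1) / (c * d)))) := by
  induction n generalizing e f with
  | zero => simp [wpTerm]
  | succ n ih =>
    obtain ⟨E, rfl⟩ : ∃ E, e = E * Q := ⟨e / Q, (div_mul_cancel₀ e hQ).symm⟩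
    have hrec := jackson_recurrence a b c d E f Q _ ha hb hc hd hQ n rfl hf
      (mul_right_cancel₀ hQ (by rw [← h]; ring)) hQi hbi hci hdi hai hbcd
    have hprev := ih (fun i hi => hQi i (by lia)) (fun i hi => hbi i (by lia))
      (fun i hi => hci i (by lia)) (fun i hi => hdi i (by lia)) (fun i hi => hai i (by lia))
      (fun i hi => hbcd i (by lia)) E (f * Q) (by rw [← hf]; ring) (by rw [← h]; ring)
    rw [prod_range_succ, prod_range_succ, ← mul_assoc (1 - a), ← hprev]
    linear_combination (∏ i ∈ range n,
        ((1 - a * Q ^ (i + 1) / b) * (1 - a * Q ^ (i + 1) / c) * (1 - a * Q ^ (i + 1) / d) *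
          (1 - a * Q ^ (i + 1) / (b * c * d)))) * hrec

end Jackson

section ClearedSum

variable {A B : Type*} [CommRing A] [CommRing B]

/-- The shifted factorial `(q ^ r z; q ^ 3)_m` over a commutative ring. -/
def qShiftedCube (q : A) (r : ℕ) (z : A) (m : ℕ) : A :=
  ∏ i ∈ range m, (1 - q ^ (3 * i + r) * z)

theorem map_qShiftedCube (φ : A →+* B) (q : A) (r : ℕ) (z : A) (m : ℕ) :
    φ (qShiftedCube q r z m) = qShiftedCube (φ q) r (φ z) m := by
  simp [qShiftedCube]

theorem qShiftedCube_add (q : A) (r : ℕ) (z : A) (k l : ℕ) :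
    qShiftedCube q r z (k + l) = qShiftedCube q r z k * qShiftedCube q (3 * k + r) z l := by
  simp only [qShiftedCube, prod_range_add, mul_add, add_assoc, add_left_comm (3 * k)]

/-- The truncated very-well-poised sum with base `q ^ 3` and parameters `q x_j`, multiplied by its
common denominator; here `y_j` plays the role of `1 / x_j`. -/
def clearedSum (q : A) (x y : Fin 6 → A) (m : ℕ) : A :=
  ∑ p ∈ antidiagonal m, (1 - q ^ (6 * p.1 + 1)) * q ^ (3 * p.1) *
    ∏ j, (qShiftedCube q 1 (x j) p.1 * qShiftedCube q (3 * p.1 + 3) (y j) p.2)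

theorem map_clearedSum (φ : A →+* B) (q : A) (x y : Fin 6 → A) (m : ℕ) :
    φ (clearedSum q x y m) = clearedSum (φ q) (φ ∘ x) (φ ∘ y) m := by
  simp [clearedSum, map_qShiftedCube]

theorem clearedSum_comp_equiv (q : A) (x y : Fin 6 → A) (m : ℕ) (σ : Equiv.Perm (Fin 6)) :
    clearedSum q (x ∘ σ) (y ∘ σ) m = clearedSum q x y m :=
  sum_congr rfl fun p _ => congrArg _ <| Equiv.prod_comp σ fun j =>
    qShiftedCube q 1 (x j) p.1 * qShiftedCube q (3 * p.1 + 3) (y j) p.2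

theorem qShiftedCube_reflect {q x y : A} {k l : ℕ} (hq : q ^ (3 * (k + l) + 1) = 1)
    (hxy : x * y = 1) :
    qShiftedCube q (3 * k + 3) y l =
      qShiftedCube q 1 x l * ∏ i ∈ range l, -(q ^ (3 * i + (3 * k + 3)) * y) := by
  rw [qShiftedCube, qShiftedCube, ← prod_range_reflect (fun i => 1 - q ^ (3 * i + 1) * x),
    ← prod_mul_distrib]
  refine prod_congr rfl fun i hi => ?_
  have hpow : q ^ (3 * (l - 1 - i) + 1) * q ^ (3 * i + (3 * k + 3)) = 1 := by
    rw [← pow_add, ← hq]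
    congr 1
    have := mem_range.mp hi
    lia
  linear_combination -hpow - q ^ (3 * (l - 1 - i) + 1) * q ^ (3 * i + (3 * k + 3)) * hxy

theorem prod_reflection_weight {q : A} {y : Fin 6 → A} (hy : ∏ j, y j = 1) (k l : ℕ) :
    ∏ j, ∏ i ∈ range l, -(q ^ (3 * i + (3 * k + 3)) * y j) = q ^ (9 * l * (l + 2 * k + 1)) := by
  have hfactor (c : A) : ∏ j, -(c * y j) = c ^ 6 := by
    simp only [← neg_mul, prod_mul_distrib, hy, prod_const, card_univ, Fintype.card_fin, mul_one,
      Even.neg_pow (by decide : Even 6)]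
  rw [prod_comm]
  simp only [hfactor]
  induction l with
  | zero => simp
  | succ l ih =>
    rw [prod_range_succ, ih]
    ring

/-- If `q ^ (3 m + 1) = 1`, the very-well-poised sum is antisymmetric under `k ↦ m - k`. -/
theorem clearedSum_eq_zero [NoZeroDivisors A] [CharZero A] {q : A} {x y : Fin 6 → A} {m : ℕ}
    (hq : q ^ (3 * m + 1) = 1) (hxy : ∀ j, x j * y j = 1) (hx : ∏ j, x j = 1) :
    clearedSum q x y m = 0 := by
  have hy : ∏ j, y j = 1 := by
    simpa only [hxy, prod_const_one, prod_mul_distrib, hx, one_mul] using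
      (prod_mul_distrib (s := univ) (f := x) (g := y)).symm
  have hterm {k l : ℕ} (hkl : k + l = m) :
      ∏ j, (qShiftedCube q 1 (x j) k * qShiftedCube q (3 * k + 3) (y j) l) =
        (∏ j, qShiftedCube q 1 (x j) k) * (∏ j, qShiftedCube q 1 (x j) l) *
          q ^ (9 * l * (l + 2 * k + 1)) := by
    subst hkl
    simp only [qShiftedCube_reflect hq (hxy _), prod_mul_distrib, prod_reflection_weight hy]
    ring
  have hweight {k l : ℕ} (hkl : k + l = m) :
      q ^ (6 * k + 1) * (q ^ (3 * k) * q ^ (9 * l * (l + 2 * k + 1))) =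
        q ^ (3 * l) * q ^ (9 * k * (k + 2 * l + 1)) := by
    have hperiod (e : ℕ) : q ^ ((3 * m + 1) * e) = 1 := by rw [pow_mul, hq, one_pow]
    rw [← mul_one (_ * _), ← hperiod (3 * k), ← mul_one (q ^ (3 * l) * _), ← hperiod (3 * l + 1),
      ← hkl]
    ring
  have hdouble : clearedSum q x y m + clearedSum q x y m = 0 := by
    nth_rewrite 2 [clearedSum]
    rw [← Nat.sum_antidiagonal_swap, clearedSum, ← sum_add_distrib]
    refine sum_eq_zero fun ⟨k, l⟩ hkl => ?_
    have hkl : k + l = m := mem_antidiagonal.mp hkl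
    have hlk : l + k = m := by rw [add_comm, hkl]
    simp only [Prod.swap, hterm hkl, hterm hlk]
    linear_combination (-(∏ j, qShiftedCube q 1 (x j) k) * ∏ j, qShiftedCube q 1 (x j) l) *
      (hweight hkl + hweight hlk)
  exact self_eq_neg.mp (eq_neg_of_add_eq_zero_left hdouble)

end ClearedSum

section ClearedJackson

theorem one_sub_mul_qShiftedCube_four {A : Type*} [CommRing A] (q : A) (m : ℕ) :
    (1 - q) * qShiftedCube q 4 1 m = qShiftedCube q 1 1 m * (1 - q ^ (3 * m + 1)) := by
  have hsplit := qShiftedCube_add q 1 1 1 m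
  rw [add_comm 1 m, qShiftedCube_add] at hsplit
  simpa [qShiftedCube] using hsplit.symm

section Field

variable {F : Type*} [Field F] {q : F} {x y : Fin 6 → F} {m : ℕ}

theorem wpFactor_cube (hq : q ≠ 0) {u v : F} (huv : u * v = 1) (i : ℕ) :
    wpFactor q (q ^ 3) (q * u) i = (1 - q ^ (3 * i + 1) * u) / (1 - q ^ (3 * i + 3) * v) := by
  obtain rfl : v = u⁻¹ := eq_inv_of_mul_eq_one_right huv
  have hu : u ≠ 0 := left_ne_zero_of_mul_eq_one huv
  rw [wpFactor, ← pow_mul, ← pow_mul]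
  congr 2
  · ring
  · field_simp
    ring

theorem clearedSum_eq_sum_wpTerm (hq : q ≠ 0) (hxy : ∀ j, x j * y j = 1) (hx0 : x 0 = 1)
    (hy : ∀ i < m, ∀ j, q ^ (3 * i + 3) * y j ≠ 1) :
    clearedSum q x y m =
      (∑ k ∈ range (m + 1), wpTerm q (q * x 1) (q * x 2) (q * x 3) (q * x 4) (q * x 5) (q ^ 3) k) *
        ∏ j, qShiftedCube q 3 (y j) m := by
  have hfactor (i : ℕ) : wpFactors q (q * x 1) (q * x 2) (q * x 3) (q ^ 3) i *
      (wpFactor q (q ^ 3) (q * x 4) i * wpFactor q (q ^ 3) (q * x 5) i) =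
      ∏ j, (1 - q ^ (3 * i + 1) * x j) / (1 - q ^ (3 * i + 3) * y j) := by
    have hzero := wpFactor_cube hq (hxy 0) i
    rw [hx0, mul_one] at hzero
    rw [Fin.prod_univ_six, hx0]
    simp only [wpFactors, hzero, wpFactor_cube hq (hxy _)]
    ring
  rw [clearedSum, Nat.sum_antidiagonal_eq_sum_range_succ_mk, sum_mul]
  refine sum_congr rfl fun k hk => ?_
  have hk : k ≤ m := mem_range_succ_iff.mp hk
  rw [wpTerm, prod_congr rfl fun i _ => hfactor i, prod_comm, mul_assoc _ (∏ j, _),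
    ← prod_mul_distrib]
  congr 1
  · ring
  · refine prod_congr rfl fun j _ => ?_
    have hden : qShiftedCube q 3 (y j) k ≠ 0 :=
      prod_ne_zero_iff.mpr fun i hi =>
        sub_ne_zero.mpr (hy i (lt_of_lt_of_le (mem_range.mp hi) hk) j).symm
    obtain ⟨l, rfl⟩ := Nat.exists_eq_add_of_le hk
    rw [prod_div_distrib, qShiftedCube_add, add_tsub_cancel_left, ← mul_assoc]
    exact congrArg (· * _) (div_mul_cancel₀ _ hden).symm

theorem jackson_sum_cube (hq : q ≠ 0) (hxy : ∀ j, x j * y j = 1)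
    (hprod : x 1 * x 2 * x 3 * x 4 * x 5 = 1) (hx5 : q ^ (3 * m + 1) * x 5 = 1)
    (hroot : ∀ i, q ^ (i + 1) ≠ 1) (hy : ∀ i < m, ∀ j, q ^ (3 * i + 3) * y j ≠ 1)
    (hx123 : ∀ i, q ^ (3 * i) ≠ q ^ 2 * (x 1 * x 2 * x 3)) :
    (∑ k ∈ range (m + 1), wpTerm q (q * x 1) (q * x 2) (q * x 3) (q * x 4) (q * x 5) (q ^ 3) k) *
        (qShiftedCube q 3 (y 1) m * qShiftedCube q 3 (y 2) m * qShiftedCube q 3 (y 3) m *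
          qShiftedCube q 1 (y 1 * y 2 * y 3) m) =
      (1 - q) * (qShiftedCube q 4 1 m * (qShiftedCube q 2 (y 1 * y 2) m *
        qShiftedCube q 2 (y 1 * y 3) m * qShiftedCube q 2 (y 2 * y 3) m)) := by
  obtain rfl : y = fun j => (x j)⁻¹ := funext fun j => eq_inv_of_mul_eq_one_right (hxy j)
  have hx (j : Fin 6) : x j ≠ 0 := left_ne_zero_of_mul_eq_one (hxy j)
  have hx1 := hx 1; have hx2 := hx 2; have hx3 := hx 3
  have hcube (i : ℕ) : q * (q ^ 3) ^ (i + 1) = q ^ (3 * i + 4) := by ring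
  have hone (i : ℕ) (j : Fin 6) :
      q ^ (3 * i + 4) / (q * x j) = q ^ (3 * i + 3) * (x j)⁻¹ := by
    have := hx j
    field_simp
    ring
  have htwo (i : ℕ) (j k : Fin 6) : q ^ (3 * i + 4) / (q * x j * (q * x k)) =
      q ^ (3 * i + 2) * ((x j)⁻¹ * (x k)⁻¹) := by
    have := hx j; have := hx k
    field_simp
    ring
  have hthree (i : ℕ) : q ^ (3 * i + 4) / (q * x 1 * (q * x 2) * (q * x 3)) =
      q ^ (3 * i + 1) * ((x 1)⁻¹ * (x 2)⁻¹ * (x 3)⁻¹) := by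
    field_simp
    ring
  have hden (j : Fin 6) (i : ℕ) (hi : i < m) : 1 - q * (q ^ 3) ^ (i + 1) / (q * x j) ≠ 0 := by
    rw [hcube, hone, sub_ne_zero]
    exact (hy i hi j).symm
  have hsum := jackson_sum q (q * x 1) (q * x 2) (q * x 3) (q ^ 3) hq (mul_ne_zero hq (hx _))
    (mul_ne_zero hq (hx _)) (mul_ne_zero hq (hx _)) (pow_ne_zero _ hq) m
    (fun i _ => by rw [← pow_mul, sub_ne_zero]; exact (hroot (3 * i + 2)).symm)
    (hden 1) (hden 2) (hden 3)
    (fun i _ => by rw [hcube, sub_ne_zero]; exact (hroot (3 * i + 3)).symm)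
    (fun i _ => by
      have hi := hx123 i
      contrapose! hi
      rw [← pow_mul] at hi
      field_simp at hi
      linear_combination -hi)
    (q * x 4) (q * x 5) (by rw [← hx5]; ring) (by linear_combination q ^ 5 * hprod)
  simp only [hcube, hone, htwo, hthree, prod_mul_distrib] at hsum
  simpa only [qShiftedCube, mul_one] using hsum

end Field

/-- Jackson's sum for the base `q ^ 3` and the parameters `q x_j`, with denominators cleared. -/
theorem clearedSum_mul_eq {A : Type*} [CommRing A] [IsDomain A] {q : A} (x y : Fin 6 → A) (m : ℕ)
    (hq : q ≠ 0) (hxy : ∀ j, x j * y j = 1) (hx0 : x 0 = 1)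
    (hprod : x 1 * x 2 * x 3 * x 4 * x 5 = 1) (hx5 : q ^ (3 * m + 1) * x 5 = 1)
    (hroot : ∀ i, q ^ (i + 1) ≠ 1) (hy : ∀ i < m, ∀ j, q ^ (3 * i + 3) * y j ≠ 1)
    (hx123 : ∀ i, q ^ (3 * i) ≠ q ^ 2 * (x 1 * x 2 * x 3)) :
    clearedSum q x y m * qShiftedCube q 1 (y 1 * y 2 * y 3) m =
      (1 - q ^ (3 * m + 1)) * (qShiftedCube q 3 1 m * qShiftedCube q 1 1 m *
        (qShiftedCube q 3 (y 4) m * qShiftedCube q 3 (y 5) m) *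
        (qShiftedCube q 2 (y 1 * y 2) m * qShiftedCube q 2 (y 1 * y 3) m *
          qShiftedCube q 2 (y 2 * y 3) m)) := by
  let φ := algebraMap A (FractionRing A)
  have hφ : Function.Injective φ := IsFractionRing.injective A (FractionRing A)
  have hy0 : y 0 = 1 := by simpa [hx0] using hxy 0
  have hφxy (j : Fin 6) : (φ ∘ x) j * (φ ∘ y) j = 1 := by simp [← map_mul, hxy]
  have hφy (i : ℕ) (hi : i < m) (j : Fin 6) : φ q ^ (3 * i + 3) * (φ ∘ y) j ≠ 1 := by
    simpa only [Function.comp_apply, map_mul, map_pow, map_one] using hφ.ne (hy i hi j)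
  have hφq : φ q ≠ 0 := (map_ne_zero_iff φ hφ).mpr hq
  have hsum := jackson_sum_cube (q := φ q) (x := φ ∘ x) (y := φ ∘ y) (m := m) hφq hφxy
    (by simp only [Function.comp_apply, ← map_mul, hprod, map_one])
    (by simp only [Function.comp_apply, ← map_mul, ← map_pow, hx5, map_one])
    (fun i => by simpa only [map_pow, map_one] using hφ.ne (hroot i)) hφy
    (fun i => by simpa only [Function.comp_apply, map_mul, map_pow] using hφ.ne (hx123 i))
  apply hφ
  rw [map_mul, map_clearedSum, clearedSum_eq_sum_wpTerm hφq hφxy (by simp [hx0]) hφy,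
    Fin.prod_univ_six]
  simp only [map_qShiftedCube, map_mul, map_sub, map_one, map_pow, Function.comp_apply, hy0]
    at hsum ⊢
  linear_combination
    (qShiftedCube (φ q) 3 1 m * qShiftedCube (φ q) 3 (φ (y 4)) m *
      qShiftedCube (φ q) 3 (φ (y 5)) m) * (hsum +
      qShiftedCube (φ q) 2 (φ (y 1) * φ (y 2)) m * qShiftedCube (φ q) 2 (φ (y 1) * φ (y 3)) m *
        qShiftedCube (φ q) 2 (φ (y 2) * φ (y 3)) m * one_sub_mul_qShiftedCube_four (φ q) m)

end ClearedJackson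

section ExponentialSums

open PowerSeries
open scoped Nat

/-- The power series `exp (a s)` in `s`, as a character in `a`. -/
noncomputable def expSeries : AddChar ℂ ℂ⟦X⟧ where
  toFun a := rescale a (exp ℂ)
  map_zero_eq_one' := by simp
  map_add_eq_mul' a b := (exp_mul_exp_eq_exp_add a b).symm

theorem coeff_expSeries (a : ℂ) (i : ℕ) : coeff i (expSeries a) = a ^ i / i ! := by
  simp [expSeries, coeff_rescale, coeff_exp, div_eq_mul_inv]

/-- Finite sums of terms `r exp (a s + b t)`, with `(a, b)` as the exponent of a monomial. -/
abbrev ExpSum : Type := AddMonoidAlgebra ℂ (ℂ × ℂ)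

namespace ExpSum

/-- The restriction of an exponential sum in `s, t` to the line `(s, t) = (α X, β X)`. -/
noncomputable def restrict (α β : ℂ) : ExpSum →ₐ[ℂ] ℂ⟦X⟧ :=
  AddMonoidAlgebra.lift ℂ ℂ⟦X⟧ (ℂ × ℂ) (expSeries.compAddMonoidHom
    ((AddMonoidHom.mulRight α).coprod (AddMonoidHom.mulRight β))).toMonoidHom

theorem restrict_single (α β : ℂ) (p : ℂ × ℂ) (r : ℂ) :
    restrict α β (AddMonoidAlgebra.single p r) = C r * expSeries (p.1 * α + p.2 * β) := by
  simp [restrict, smul_eq_C_mul]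

/-- The coefficient of `s ^ i t ^ j` in the Taylor expansion of an exponential sum. -/
noncomputable def taylorCoeff (i j : ℕ) : ExpSum →+ ℂ :=
  AddMonoidAlgebra.liftNC (AddMonoidHom.id ℂ) fun p =>
    p.toAdd.1 ^ i / i ! * (p.toAdd.2 ^ j / j !)

theorem taylorCoeff_single (i j : ℕ) (p : ℂ × ℂ) (r : ℂ) :
    taylorCoeff i j (AddMonoidAlgebra.single p r) = r * (p.1 ^ i / i ! * (p.2 ^ j / j !)) := by
  simp [taylorCoeff, AddMonoidAlgebra.liftNC_single]

theorem coeff_restrict (α β : ℂ) (k : ℕ) (u : ExpSum) :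
    coeff k (restrict α β u) =
      ∑ p ∈ antidiagonal k, α ^ p.1 * β ^ p.2 * taylorCoeff p.1 p.2 u := by
  induction u using AddMonoidAlgebra.induction_linear with
  | zero => simp
  | add u v hu hv => simp only [map_add, hu, hv, mul_add, sum_add_distrib]
  | single p r =>
    rw [restrict_single, AddChar.map_add_eq_mul, coeff_C_mul, coeff_mul, mul_sum]
    refine sum_congr rfl fun ij _ => ?_
    rw [coeff_expSeries, coeff_expSeries, taylorCoeff_single]
    ring

theorem taylorCoeff_zero_eq_zero {u : ExpSum} (hu : restrict 0 1 u = 0) (j : ℕ) :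
    taylorCoeff 0 j u = 0 := by
  have hcoeff := coeff_restrict 0 1 j u
  rw [hu, map_zero, sum_eq_single (0, j)] at hcoeff
  · simpa using hcoeff.symm
  · rintro ⟨i, k⟩ hik hne
    have hi : i ≠ 0 := by
      rintro rfl
      exact hne (Prod.ext rfl (by simpa using mem_antidiagonal.mp hik))
    simp [hi]
  · simp

/-- The substitution `t ↦ w t`. -/
noncomputable def rotate (w : ℂ) : ExpSum →+* ExpSum :=
  AddMonoidAlgebra.mapDomainRingHom ℂ ((AddMonoidHom.id ℂ).prodMap (AddMonoidHom.mulLeft w))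

theorem rotate_single (w : ℂ) (p : ℂ × ℂ) (r : ℂ) :
    rotate w (AddMonoidAlgebra.single p r) = AddMonoidAlgebra.single (p.1, w * p.2) r := by
  simp [rotate, Prod.map]

theorem taylorCoeff_rotate (w : ℂ) (i j : ℕ) (u : ExpSum) :
    taylorCoeff i j (rotate w u) = w ^ j * taylorCoeff i j u := by
  induction u using AddMonoidAlgebra.induction_linear with
  | zero => simp
  | add u v hu hv => simp only [map_add, hu, hv, mul_add]
  | single p r =>
    rw [rotate_single, taylorCoeff_single, taylorCoeff_single, mul_pow]
    ring

/-- Vanishing at `s = 0` and invariance under `t ↦ w t` leave only the monomials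
`s ^ i t ^ (N j)` with `0 < i`. -/
theorem X_pow_dvd_restrict_sub {w : ℂ} {N : ℕ} (hw : IsPrimitiveRoot w N) {u : ExpSum}
    (hzero : restrict 0 1 u = 0) (hrotate : rotate w u = u) (c : ℂ) :
    (X : ℂ⟦X⟧) ^ (N + 1) ∣ restrict 1 c u - restrict 1 0 u := by
  rw [X_pow_dvd_iff]
  intro k hk
  rw [map_sub, coeff_restrict, coeff_restrict, sub_eq_zero]
  refine sum_congr rfl fun ⟨i, j⟩ hij => ?_
  have hij : i + j = k := mem_antidiagonal.mp hij
  rcases eq_or_ne j 0 with rfl | hj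
  · simp
  suffices taylorCoeff i j u = 0 by simp [this]
  rcases eq_or_ne i 0 with rfl | hi
  · exact taylorCoeff_zero_eq_zero hzero j
  · have hne : w ^ j ≠ 1 := hw.pow_ne_one_of_pos_of_lt hj (by lia)
    have hfix := taylorCoeff_rotate w i j u
    rw [hrotate] at hfix
    exact eq_zero_of_mul_eq_self_left hne hfix.symm

end ExpSum

end ExponentialSums

section LeadingTerms

open PowerSeries
open scoped Nat

/-- The two leading terms of a power series: `f = v X ^ a (1 + l X) + O(X ^ (a + 2))`. -/
def HasLeadingTerms (f : ℂ⟦X⟧) (a : ℕ) (v l : ℂ) : Prop :=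
  X ^ (a + 2) ∣ f - C v * X ^ a * (1 + C l * X)

namespace HasLeadingTerms

variable {f g : ℂ⟦X⟧} {a b : ℕ} {v l v' l' : ℂ}

theorem one : HasLeadingTerms 1 0 1 0 := by simp [HasLeadingTerms]

theorem const_mul (hf : HasLeadingTerms f a v l) (c : ℂ) :
    HasLeadingTerms (C c * f) a (c * v) l := by
  obtain ⟨u, hu⟩ := hf
  refine ⟨C c * u, ?_⟩
  rw [map_mul]
  linear_combination C c * hu

theorem mul (hf : HasLeadingTerms f a v l) (hg : HasLeadingTerms g b v' l') :
    HasLeadingTerms (f * g) (a + b) (v * v') (l + l') := by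
  obtain ⟨u, hu⟩ := hf
  obtain ⟨u', hu'⟩ := hg
  rw [sub_eq_iff_eq_add'] at hu hu'
  refine ⟨C v * C v' * C l * C l' + u * (C v' * (1 + C l' * X)) + C v * (1 + C l * X) * u' +
    X ^ 2 * u * u', ?_⟩
  rw [hu, hu', map_mul, map_add]
  ring

theorem prod {ι : Type*} {f : ι → ℂ⟦X⟧} {a : ι → ℕ} {v l : ι → ℂ} (s : Finset ι)
    (hf : ∀ i ∈ s, HasLeadingTerms (f i) (a i) (v i) (l i)) :
    HasLeadingTerms (∏ i ∈ s, f i) (∑ i ∈ s, a i) (∏ i ∈ s, v i) (∑ i ∈ s, l i) := by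
  classical
  induction s using Finset.induction_on with
  | empty => simpa using one
  | insert i s hi ih =>
    rw [prod_insert hi, prod_insert hi, sum_insert hi, sum_insert hi]
    exact (hf i (mem_insert_self i s)).mul (ih fun j hj => hf j (mem_insert_of_mem hj))

theorem X_pow_dvd_sub (hf : HasLeadingTerms f a v l) (hg : HasLeadingTerms g a v' l')
    (hv : v = v') (hl : l = l') : X ^ (a + 2) ∣ f - g := by
  subst hv hl
  simpa only [sub_sub_sub_cancel_right] using dvd_sub hf hg

theorem one_sub_mul_expSeries {z : ℂ} (hz : z ≠ 1) (α : ℂ) :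
    HasLeadingTerms (1 - C z * expSeries α) 0 (1 - z) (-(α * (z / (1 - z)))) := by
  have hz' : 1 - z ≠ 0 := sub_ne_zero.mpr hz.symm
  rw [HasLeadingTerms, X_pow_dvd_iff, pow_zero, mul_one]
  intro i hi
  simp only [mul_add, mul_one, ← mul_assoc, map_sub, map_add, coeff_C_mul, coeff_C, coeff_one,
    coeff_expSeries]
  interval_cases i
  · simp
  · simp
    field_simp
    ring

theorem one_sub_expSeries (α : ℂ) : HasLeadingTerms (1 - expSeries α) 1 (-α) (α / 2) := by
  rw [HasLeadingTerms, X_pow_dvd_iff, pow_one]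
  intro i hi
  simp only [mul_add, mul_one, mul_left_comm _ (C (α / 2)), mul_assoc, ← sq, map_sub, map_add,
    coeff_C_mul, coeff_X, coeff_X_pow, coeff_one, coeff_expSeries]
  interval_cases i
  · simp
  · simp
  · simp
    ring

end HasLeadingTerms

/-- The base `q = ζ exp s`, as a power series in `s`. -/
noncomputable def deformedRoot (ζ : ℂ) : ℂ⟦X⟧ := C ζ * expSeries 1

theorem deformedRoot_pow (ζ : ℂ) (k : ℕ) : deformedRoot ζ ^ k = C (ζ ^ k) * expSeries k := by
  rw [deformedRoot, mul_pow, ← AddChar.map_nsmul_eq_pow, nsmul_one, map_pow]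

theorem deformedRoot_pow_mul (ζ : ℂ) (k : ℕ) (δ : ℂ) :
    deformedRoot ζ ^ k * expSeries δ = C (ζ ^ k) * expSeries (k + δ) := by
  rw [deformedRoot_pow, AddChar.map_add_eq_mul, mul_assoc]

/-- The product `(q ^ r exp (δ s); q ^ 3)_m` for `q = ζ exp s`. -/
noncomputable def deformedShifted (ζ : ℂ) (r m : ℕ) (δ : ℂ) : ℂ⟦X⟧ :=
  qShiftedCube (deformedRoot ζ) r (expSeries δ) m

/-- The sum of `z / (1 - z)` over `z = ζ ^ (3 i + r)` with `i ∈ s`; up to sign, the derivative at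
`δ = 0` of the logarithm of the product of the factors `1 - z exp δ`. -/
noncomputable def logSlope (ζ : ℂ) (r : ℕ) (s : Finset ℕ) : ℂ :=
  ∑ i ∈ s, ζ ^ (3 * i + r) / (1 - ζ ^ (3 * i + r))

theorem exists_hasLeadingTerms_prod {ζ : ℂ} {r : ℕ} {s : Finset ℕ}
    (hs : ∀ i ∈ s, ζ ^ (3 * i + r) ≠ 1) :
    ∃ v l, ∀ δ, HasLeadingTerms (∏ i ∈ s, (1 - deformedRoot ζ ^ (3 * i + r) * expSeries δ))
      0 v (l - δ * logSlope ζ r s) := by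
  refine ⟨∏ i ∈ s, (1 - ζ ^ (3 * i + r)),
    ∑ i ∈ s, -((3 * i + r : ℕ) * (ζ ^ (3 * i + r) / (1 - ζ ^ (3 * i + r)))), fun δ => ?_⟩
  simp only [deformedRoot_pow_mul]
  convert! HasLeadingTerms.prod s fun i hi =>
    HasLeadingTerms.one_sub_mul_expSeries (hs i hi) ((3 * i + r : ℕ) + δ) using 1
  · simp
  · rw [logSlope, mul_sum, ← sum_sub_distrib]
    exact sum_congr rfl fun i _ => by ring

section PrimitiveRoot

variable {M : Type*} [CommMonoid M] {ζ : M} {t i : ℕ}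

theorem pow_three_mul_add_one_ne_one (hζ : IsPrimitiveRoot ζ (3 * t + 2)) (hi : i < 2 * t + 1) :
    ζ ^ (3 * i + 1) ≠ 1 := by
  rw [Ne, hζ.pow_eq_one_iff_dvd]
  rintro ⟨j, hj⟩
  have : j < 2 := by by_contra!; nlinarith
  interval_cases j <;> lia

theorem pow_three_mul_add_two_ne_one (hζ : IsPrimitiveRoot ζ (3 * t + 2)) (hi : i < 2 * t + 1)
    (hit : i ≠ t) : ζ ^ (3 * i + 2) ≠ 1 := by
  rw [Ne, hζ.pow_eq_one_iff_dvd]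
  rintro ⟨j, hj⟩
  have : j < 2 := by by_contra!; nlinarith
  interval_cases j <;> lia

theorem pow_three_mul_add_three_ne_one (hζ : IsPrimitiveRoot ζ (3 * t + 2))
    (hi : i < 3 * t + 1) : ζ ^ (3 * i + 3) ≠ 1 := by
  rw [Ne, hζ.pow_eq_one_iff_dvd, show 3 * i + 3 = 3 * (i + 1) by ring]
  intro hdvd
  have hcoprime : Nat.Coprime (3 * t + 2) 3 := by
    rw [Nat.coprime_comm, Nat.coprime_mul_left_add_right]
    norm_num
  exact absurd (Nat.le_of_dvd (by lia) (hcoprime.dvd_of_dvd_mul_left hdvd)) (by lia)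

end PrimitiveRoot

theorem div_one_sub_add_div_one_sub {F : Type*} [Field F] {z z' : F} (h : z * z' = 1)
    (hz : z ≠ 1) : z / (1 - z) + z' / (1 - z') = -1 := by
  have h0 : z ≠ 0 := left_ne_zero_of_mul_eq_one h
  have h1 : 1 - z ≠ 0 := sub_ne_zero.mpr hz.symm
  have h2 : z - 1 ≠ 0 := sub_ne_zero.mpr hz
  rw [eq_inv_of_mul_eq_one_right h]
  field_simp
  ring

theorem logSlope_one_add_three {ζ : ℂ} {m : ℕ} (hm : ζ ^ (3 * m + 1) = 1)
    (hne : ∀ i < m, ζ ^ (3 * i + 1) ≠ 1) :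
    logSlope ζ 1 (range m) + logSlope ζ 3 (range m) = -m := by
  rw [logSlope, logSlope, ← sum_range_reflect (fun i => _ / (1 - ζ ^ (3 * i + 3))),
    ← sum_add_distrib, sum_congr rfl (g := fun _ => -1)]
  · simp
  · intro i hi
    have hi : i < m := mem_range.mp hi
    refine div_one_sub_add_div_one_sub ?_ (hne i hi)
    rw [← pow_add, show 3 * i + 1 + (3 * (m - 1 - i) + 3) = 3 * m + 1 by lia, hm]

theorem logSlope_two {ζ : ℂ} {t : ℕ} (ht : ζ ^ (3 * t + 2) = 1)
    (hne : ∀ i ∈ (range (2 * t + 1)).erase t, ζ ^ (3 * i + 2) ≠ 1) :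
    logSlope ζ 2 ((range (2 * t + 1)).erase t) = -t := by
  have hreflect : logSlope ζ 2 ((range (2 * t + 1)).erase t) =
      ∑ i ∈ (range (2 * t + 1)).erase t,
        ζ ^ (3 * (2 * t - i) + 2) / (1 - ζ ^ (3 * (2 * t - i) + 2)) := by
    refine sum_nbij' (2 * t - ·) (2 * t - ·) ?_ ?_ ?_ ?_ ?_ <;> intro i hi <;>
      simp only [mem_erase, mem_range] at hi ⊢
    any_goals lia
    rw [show 2 * t - (2 * t - i) = i by lia]
  have hdouble : logSlope ζ 2 ((range (2 * t + 1)).erase t) +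
      logSlope ζ 2 ((range (2 * t + 1)).erase t) = -(2 * t) := by
    nth_rewrite 2 [hreflect]
    rw [logSlope, ← sum_add_distrib, sum_congr rfl (g := fun _ => -1)]
    · rw [sum_const, card_erase_of_mem (mem_range.mpr (by lia)), card_range]
      simp
    · intro i hi
      refine div_one_sub_add_div_one_sub ?_ (hne i hi)
      simp only [mem_erase, mem_range] at hi
      rw [← pow_add, show 3 * i + 2 + (3 * (2 * t - i) + 2) = (3 * t + 2) * 2 by lia, pow_mul,
        ht, one_pow]
  linear_combination hdouble / 2

theorem exists_hasLeadingTerms_deformedShifted {ζ : ℂ} {r m : ℕ}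
    (hne : ∀ i < m, ζ ^ (3 * i + r) ≠ 1) :
    ∃ v l, ∀ δ, HasLeadingTerms (deformedShifted ζ r m δ) 0 v
      (l - δ * logSlope ζ r (range m)) :=
  exists_hasLeadingTerms_prod fun i hi => hne i (mem_range.mp hi)

theorem exists_hasLeadingTerms_deformedShifted_two {ζ : ℂ} {t : ℕ}
    (hζ : IsPrimitiveRoot ζ (3 * t + 2)) :
    ∃ v l, ∀ δ, HasLeadingTerms (deformedShifted ζ 2 (2 * t + 1) δ) 1
      (-((3 * t + 2 : ℕ) + δ) * v) (((3 * t + 2 : ℕ) + δ) / 2 + (l + δ * t)) := by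
  have hne : ∀ i ∈ (range (2 * t + 1)).erase t, ζ ^ (3 * i + 2) ≠ 1 := fun i hi =>
    pow_three_mul_add_two_ne_one hζ (mem_range.mp (mem_of_mem_erase hi)) (ne_of_mem_erase hi)
  obtain ⟨v, l, h⟩ := exists_hasLeadingTerms_prod hne
  refine ⟨v, l, fun δ => ?_⟩
  have hroot : 1 - expSeries ((3 * t + 2 : ℕ) + δ) =
      1 - deformedRoot ζ ^ (3 * t + 2) * expSeries δ := by
    rw [deformedRoot_pow_mul, hζ.pow_eq_one, map_one, one_mul]
  have hprod := (HasLeadingTerms.one_sub_expSeries ((3 * t + 2 : ℕ) + δ)).mul (h δ)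
  rwa [hroot, logSlope_two hζ.pow_eq_one hne, mul_neg, sub_neg_eq_add, add_zero,
    mul_prod_erase (range (2 * t + 1)) (fun i => 1 - deformedRoot ζ ^ (3 * i + 2) * expSeries δ)
      (mem_range.mpr (by lia))] at hprod

theorem X_pow_five_dvd_deformedShifted_sub {ζ w : ℂ} {t m n : ℕ} (hm : m = 2 * t + 1)
    (hn : n = 3 * t + 2) (hζ : IsPrimitiveRoot ζ n)
    (hw : 1 + w + w ^ 2 + w ^ 3 + w ^ 4 = 0) :
    let P r δ := deformedShifted ζ r m (2 * n * δ)
    X ^ 5 ∣ P 1 0 * P 3 (w ^ 4) * P 3 1 *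
        (P 2 (w + w ^ 2) * P 2 (w + w ^ 3) * P 2 (w ^ 2 + w ^ 3)) -
      5 * (P 2 0 * P 2 0 * P 2 0 * (P 3 0 * P 3 0) * P 1 (w + w ^ 2 + w ^ 3)) := by
  intro _
  subst hm hn
  have hpow : ζ ^ (3 * (2 * t + 1) + 1) = 1 := by
    rw [show 3 * (2 * t + 1) + 1 = (3 * t + 2) * 2 by ring, pow_mul, hζ.pow_eq_one, one_pow]
  have hne_one (i : ℕ) (hi : i < 2 * t + 1) : ζ ^ (3 * i + 1) ≠ 1 :=
    pow_three_mul_add_one_ne_one hζ hi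
  obtain ⟨v₁, l₁, h₁⟩ := exists_hasLeadingTerms_deformedShifted hne_one
  obtain ⟨v₂, l₂, h₂⟩ := exists_hasLeadingTerms_deformedShifted_two hζ
  obtain ⟨v₃, l₃, h₃⟩ := exists_hasLeadingTerms_deformedShifted (m := 2 * t + 1)
    fun i hi => pow_three_mul_add_three_ne_one hζ (by lia : i < 3 * t + 1)
  rw [← map_ofNat C 5]
  refine ((((h₁ _).mul (h₃ _)).mul (h₃ _)).mul (((h₂ _).mul (h₂ _)).mul (h₂ _))).X_pow_dvd_sub
    ((((((h₂ _).mul (h₂ _)).mul (h₂ _)).mul ((h₃ _).mul (h₃ _))).mul (h₁ _)).const_mul 5) ?_ ?_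
  · have hvalue :
        (1 + 2 * (w + w ^ 2)) * (1 + 2 * (w + w ^ 3)) * (1 + 2 * (w ^ 2 + w ^ 3)) = 5 := by
      linear_combination (-4 + 8 * w + 4 * w ^ 2 + 8 * w ^ 3 + 8 * w ^ 4) * hw
    linear_combination (-(3 * t + 2 : ℕ) ^ 3 * v₁ * v₂ ^ 3 * v₃ ^ 2) * hvalue
  · have hslope := logSlope_one_add_three hpow hne_one
    push_cast at hslope ⊢
    linear_combination (-2 * (3 * t + 2) * logSlope ζ 3 (range (2 * t + 1))) * hw +
      2 * (3 * t + 2) * (w + w ^ 2 + w ^ 3) * hslope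

end LeadingTerms

section LocalExpansion

open PowerSeries

/-- The exponents `0, w, w ^ 2, w ^ 3, w ^ 4, 1` of the deformation parameters. -/
def rootExponent (w : ℂ) : Fin 6 → ℂ := ![0, w, w ^ 2, w ^ 3, w ^ 4, 1]

theorem sum_rootExponent {w : ℂ} (hw : 1 + w + w ^ 2 + w ^ 3 + w ^ 4 = 0) :
    ∑ j, rootExponent w j = 0 := by
  rw [Fin.sum_univ_six]
  simp only [rootExponent, Matrix.cons_val]
  linear_combination hw

theorem mul_rootExponent {w : ℂ} (hw : w ^ 5 = 1) (j : Fin 6) :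
    w * rootExponent w j = rootExponent w ((c[1, 2, 3, 4, 5] : Equiv.Perm (Fin 6)) j) := by
  have hcycle : ∀ j : Fin 6, (c[1, 2, 3, 4, 5] : Equiv.Perm (Fin 6)) j = ![0, 2, 3, 4, 5, 1] j := by
    decide
  rw [hcycle]
  exact match j with
    | 0 => mul_zero w
    | 1 => (sq w).symm
    | 2 => (pow_succ' w 2).symm
    | 3 => (pow_succ' w 3).symm
    | 4 => (pow_succ' w 4).symm.trans hw
    | 5 => mul_one w

/-- The cleared very-well-poised sum with base `q = ζ exp s` and parameters `exp (w ^ j t)`, as an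
exponential sum in `s` and `t`. -/
noncomputable def deformedSum (ζ w : ℂ) (m : ℕ) : ExpSum :=
  clearedSum (AddMonoidAlgebra.single (1, 0) ζ)
    (fun j => AddMonoidAlgebra.single (0, rootExponent w j) 1)
    (fun j => AddMonoidAlgebra.single (0, -rootExponent w j) 1) m

theorem restrict_deformedSum (α β ζ w : ℂ) (m : ℕ) :
    ExpSum.restrict α β (deformedSum ζ w m) =
      clearedSum (C ζ * expSeries α) (fun j => expSeries (rootExponent w j * β))
        (fun j => expSeries (-rootExponent w j * β)) m := by
  have h := map_clearedSum (ExpSum.restrict α β : ExpSum →+* ℂ⟦X⟧)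
    (AddMonoidAlgebra.single (1, 0) ζ)
    (fun j => AddMonoidAlgebra.single (0, rootExponent w j) 1)
    (fun j => AddMonoidAlgebra.single (0, -rootExponent w j) 1) m
  simpa [Function.comp_def, ExpSum.restrict_single, deformedSum] using h

theorem restrict_zero_one_deformedSum {ζ w : ℂ} {m : ℕ} (hζ : ζ ^ (3 * m + 1) = 1)
    (hw : 1 + w + w ^ 2 + w ^ 3 + w ^ 4 = 0) :
    ExpSum.restrict 0 1 (deformedSum ζ w m) = 0 := by
  have : CharZero ℂ⟦X⟧ := charZero_of_injective_ringHom (f := (C : ℂ →+* ℂ⟦X⟧)) C_injective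
  rw [restrict_deformedSum]
  refine clearedSum_eq_zero ?_ (fun j => ?_) ?_
  · rw [AddChar.map_zero_eq_one, mul_one, ← map_pow, hζ, map_one]
  · rw [← AddChar.map_add_eq_mul, neg_mul, add_neg_cancel, AddChar.map_zero_eq_one]
  · have hprod := map_prod expSeries.toMonoidHom
      (fun j => Multiplicative.ofAdd (rootExponent w j * 1)) univ
    simp only [AddChar.toMonoidHom_apply, toAdd_ofAdd, toAdd_prod, mul_one, sum_rootExponent hw,
      AddChar.map_zero_eq_one] at hprod ⊢
    exact hprod.symm

theorem rotate_deformedSum {ζ w : ℂ} {m : ℕ} (hw : w ^ 5 = 1) :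
    ExpSum.rotate w (deformedSum ζ w m) = deformedSum ζ w m := by
  rw [deformedSum, map_clearedSum, ExpSum.rotate_single, mul_zero]
  conv_rhs => rw [← clearedSum_comp_equiv _ _ _ m c[1, 2, 3, 4, 5]]
  simp only [Function.comp_def, ExpSum.rotate_single, mul_neg, mul_rootExponent hw]

theorem add_pow_eq_zero_of_isPrimitiveRoot_five {w : ℂ} (hw : IsPrimitiveRoot w 5) :
    1 + w + w ^ 2 + w ^ 3 + w ^ 4 = 0 := by
  simpa [sum_range_succ] using hw.geom_sum_eq_zero (by norm_num)

theorem add_sq_add_cube_ne_ofReal {w : ℂ} (hw : IsPrimitiveRoot w 5) (r : ℝ) :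
    w + w ^ 2 + w ^ 3 ≠ r := by
  intro h
  have hsum := add_pow_eq_zero_of_isPrimitiveRoot_five hw
  have hreal : w ^ 4 = ((-1 - r : ℝ) : ℂ) := by
    push_cast
    linear_combination hsum - h
  have hnorm := congrArg norm hreal
  rw [norm_pow, Complex.norm_eq_one_of_pow_eq_one hw.pow_eq_one (by norm_num), one_pow,
    Complex.norm_real, Real.norm_eq_abs] at hnorm
  have hsq : (-1 - r) ^ 2 = 1 := by rw [← sq_abs, ← hnorm, one_pow]
  have hpow : w ^ 8 = 1 := by
    rw [show w ^ 8 = (w ^ 4) ^ 2 by ring, hreal]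
    exact_mod_cast hsq
  exact absurd ((hw.pow_eq_one_iff_dvd 8).mp hpow) (by norm_num)

theorem constantCoeff_expSeries (a : ℂ) : constantCoeff (expSeries a) = 1 := by
  rw [← coeff_zero_eq_constantCoeff_apply, coeff_expSeries]
  simp

theorem constantCoeff_deformedRoot (ζ : ℂ) : constantCoeff (deformedRoot ζ) = ζ := by
  rw [deformedRoot, map_mul, constantCoeff_C, constantCoeff_expSeries, mul_one]

theorem deformedRoot_ne_zero {ζ : ℂ} (hζ : ζ ≠ 0) : deformedRoot ζ ≠ 0 := by
  rintro h
  exact hζ (by rw [← constantCoeff_deformedRoot ζ, h, map_zero])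

theorem deformedRoot_pow_mul_inj {ζ : ℂ} (hζ : ζ ≠ 0) {k l : ℕ} {δ ε : ℂ}
    (h : deformedRoot ζ ^ k * expSeries δ = deformedRoot ζ ^ l * expSeries ε) :
    ζ ^ k = ζ ^ l ∧ k + δ = l + ε := by
  rw [deformedRoot_pow_mul, deformedRoot_pow_mul] at h
  have h0 := congrArg (coeff 0) h
  have h1 := congrArg (coeff 1) h
  simp only [coeff_C_mul, coeff_expSeries, pow_zero, Nat.factorial, Nat.cast_one, div_one, mul_one,
    pow_one] at h0 h1
  rw [← h0] at h1
  exact ⟨h0, mul_left_cancel₀ (pow_ne_zero k hζ) h1⟩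

theorem deformedRoot_pow_succ_ne_one {ζ : ℂ} (hζ : ζ ≠ 0) (i : ℕ) :
    deformedRoot ζ ^ (i + 1) ≠ 1 := by
  intro h
  have hslope := (deformedRoot_pow_mul_inj hζ (k := i + 1) (l := 0) (δ := 0) (ε := 0)
    (by simpa using h)).2
  exact i.succ_ne_zero (by exact_mod_cast (by simpa using hslope : (i : ℂ) + 1 = 0))

theorem deformedRoot_pow_ne_sq_mul {ζ w : ℂ} {n : ℕ} (hζ : ζ ≠ 0) (hn : n ≠ 0)
    (hw : IsPrimitiveRoot w 5) (i : ℕ) :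
    deformedRoot ζ ^ (3 * i) ≠
      deformedRoot ζ ^ 2 * expSeries (-(2 * n * (w + w ^ 2 + w ^ 3))) := by
  intro h
  have hslope := (deformedRoot_pow_mul_inj hζ (k := 3 * i) (δ := 0) (by simpa using h)).2
  have hn0 : (n : ℂ) ≠ 0 := Nat.cast_ne_zero.mpr hn
  refine add_sq_add_cube_ne_ofReal hw ((2 - 3 * i) / (2 * n)) ?_
  push_cast at hslope ⊢
  rw [eq_div_iff (mul_ne_zero two_ne_zero hn0)]
  linear_combination hslope

theorem restrict_one_deformedSum_mul {ζ w : ℂ} {t m n : ℕ} (hm : m = 2 * t + 1)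
    (hn : n = 3 * t + 2) (hζ : IsPrimitiveRoot ζ n) (hw : IsPrimitiveRoot w 5) :
    let P r δ := deformedShifted ζ r m (2 * n * δ)
    ExpSum.restrict 1 (-(2 * n)) (deformedSum ζ w m) * P 1 (w + w ^ 2 + w ^ 3) =
      (1 - deformedRoot ζ ^ (2 * n)) * (P 3 0 * P 1 0 * (P 3 (w ^ 4) * P 3 1) *
        (P 2 (w + w ^ 2) * P 2 (w + w ^ 3) * P 2 (w ^ 2 + w ^ 3))) := by
  have hζ0 : ζ ≠ 0 := hζ.ne_zero (by lia)
  have hmn : 3 * m + 1 = 2 * n := by lia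
  have hζm : ζ ^ (2 * n) = 1 := by rw [mul_comm, pow_mul, hζ.pow_eq_one, one_pow]
  have hsum := add_pow_eq_zero_of_isPrimitiveRoot_five hw
  have hx (j : Fin 6) : expSeries (rootExponent w j * -(2 * n)) =
      expSeries (-(2 * n * rootExponent w j)) := congrArg expSeries (by ring)
  have hy (j : Fin 6) : expSeries (-rootExponent w j * -(2 * n)) =
      expSeries (2 * n * rootExponent w j) := congrArg expSeries (by ring)
  have hJackson := clearedSum_mul_eq (q := deformedRoot ζ)
    (fun j => expSeries (-(2 * n * rootExponent w j)))
    (fun j => expSeries (2 * n * rootExponent w j)) m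
  simp only [← AddChar.map_add_eq_mul, ← mul_add, ← neg_add, neg_add_cancel,
    AddChar.map_zero_eq_one, hmn] at hJackson
  simp only [restrict_deformedSum, hx, hy, deformedShifted, mul_zero, AddChar.map_zero_eq_one]
  refine hJackson (deformedRoot_ne_zero hζ0) (fun _ => trivial) ?_ ?_ ?_
    (deformedRoot_pow_succ_ne_one hζ0) (fun i hi j h => ?_)
    (deformedRoot_pow_ne_sq_mul hζ0 (by lia) hw)
  · simp [rootExponent]
  · have hexponents : rootExponent w 1 + rootExponent w 2 + rootExponent w 3 +
        rootExponent w 4 + rootExponent w 5 = 0 := by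
      simp only [rootExponent, Matrix.cons_val]
      linear_combination hsum
    rw [hexponents, mul_zero, neg_zero, AddChar.map_zero_eq_one]
  · rw [deformedRoot_pow_mul, hζm, map_one, one_mul]
    simp [rootExponent]
  · subst hn
    refine pow_three_mul_add_three_ne_one hζ (by lia : i < 3 * t + 1) ?_
    simpa using (deformedRoot_pow_mul_inj hζ0 (l := 0) (ε := 0) (by simpa using h)).1

theorem isUnit_deformedShifted_one {ζ : ℂ} {t : ℕ} (hζ : IsPrimitiveRoot ζ (3 * t + 2)) (δ : ℂ) :
    IsUnit (deformedShifted ζ 1 (2 * t + 1) δ) := by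
  rw [isUnit_iff_constantCoeff, isUnit_iff_ne_zero, deformedShifted, map_qShiftedCube,
    constantCoeff_deformedRoot, constantCoeff_expSeries, qShiftedCube, prod_ne_zero_iff]
  intro i hi
  rw [mul_one]
  exact sub_ne_zero.mpr (pow_three_mul_add_one_ne_one hζ (mem_range.mp hi)).symm

theorem X_pow_six_dvd_clearedSum_sub {ζ : ℂ} {t m n : ℕ} (hm : m = 2 * t + 1)
    (hn : n = 3 * t + 2) (hζ : IsPrimitiveRoot ζ n) :
    let q := deformedRoot ζ
    X ^ 6 ∣ clearedSum q 1 1 m -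
      5 * (1 - q ^ (2 * n)) * qShiftedCube q 2 1 m ^ 3 * qShiftedCube q 3 1 m ^ 3 := by
  intro q
  obtain ⟨w, hw⟩ : ∃ w : ℂ, IsPrimitiveRoot w 5 :=
    ⟨_, Complex.isPrimitiveRoot_exp 5 (by norm_num)⟩
  have hsum := add_pow_eq_zero_of_isPrimitiveRoot_five hw
  have hζm : ζ ^ (3 * m + 1) = 1 := by
    rw [show 3 * m + 1 = n * 2 by lia, pow_mul, hζ.pow_eq_one, one_pow]
  have hP (r : ℕ) : qShiftedCube q r 1 m = deformedShifted ζ r m (2 * n * 0) := by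
    rw [deformedShifted, mul_zero, AddChar.map_zero_eq_one]
  have hzero : ExpSum.restrict 1 0 (deformedSum ζ w m) = clearedSum q 1 1 m := by
    simp only [restrict_deformedSum, mul_zero, AddChar.map_zero_eq_one]
    rfl
  have hchange := ExpSum.X_pow_dvd_restrict_sub hw (restrict_zero_one_deformedSum hζm hsum)
    (rotate_deformedSum hw.pow_eq_one) (-(2 * n))
  have hvalue := restrict_one_deformedSum_mul hm hn hζ hw
  obtain ⟨u, hu⟩ : X ∣ 1 - q ^ (2 * n) := by
    rw [X_dvd_iff, map_sub, map_pow, map_one, constantCoeff_deformedRoot, mul_comm, pow_mul,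
      hζ.pow_eq_one, one_pow, sub_self]
  obtain ⟨v, hv⟩ := X_pow_five_dvd_deformedShifted_sub hm hn hζ hsum
  have hunit : IsUnit (deformedShifted ζ 1 m (2 * n * (w + w ^ 2 + w ^ 3))) := by
    subst hm hn
    exact isUnit_deformedShifted_one hζ _
  rw [hzero] at hchange
  rw [← sub_sub_sub_cancel_left _ _ (ExpSum.restrict 1 (-(2 * n)) (deformedSum ζ w m))]
  refine dvd_sub ?_ hchange
  rw [← hunit.dvd_mul_right, hP, hP]
  refine ⟨u * deformedShifted ζ 3 m (2 * n * 0) * v, ?_⟩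
  rw [hu] at hvalue ⊢
  linear_combination hvalue + X * u * deformedShifted ζ 3 m (2 * n * 0) * hv

end LocalExpansion

section LocalDivisibility

open Polynomial

theorem constantCoeff_aeval_deformedRoot (ζ : ℂ) (P : ℚ[X]) :
    PowerSeries.constantCoeff (aeval (deformedRoot ζ) P) = aeval ζ P := by
  have h := aeval_algHom_apply (PowerSeries.constantCoeff (R := ℂ)).toRatAlgHom (deformedRoot ζ) P
  exact h.symm.trans (congrArg (aeval · P) (constantCoeff_deformedRoot ζ))

theorem X_dvd_aeval_deformedRoot_iff {ζ : ℂ} {d : ℕ} (hd : 0 < d) (hζ : IsPrimitiveRoot ζ d)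
    {P : ℚ[X]} : PowerSeries.X ∣ aeval (deformedRoot ζ) P ↔ cyclotomic d ℚ ∣ P := by
  rw [PowerSeries.X_dvd_iff, constantCoeff_aeval_deformedRoot, cyclotomic_eq_minpoly_rat hζ hd,
    minpoly.dvd_iff]

theorem not_X_sq_dvd_aeval_cyclotomic {ζ : ℂ} {d : ℕ} (hd : 0 < d) (hζ : IsPrimitiveRoot ζ d) :
    ¬ PowerSeries.X ^ 2 ∣ aeval (deformedRoot ζ) (cyclotomic d ℚ) := by
  intro h
  have hdvd := h.trans (map_dvd (aeval (deformedRoot ζ)) (cyclotomic.dvd_X_pow_sub_one d ℚ))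
  rw [map_sub, map_pow, aeval_X, map_one, deformedRoot_pow, hζ.pow_eq_one, map_one, one_mul,
    PowerSeries.X_pow_dvd_iff] at hdvd
  have hcoeff := hdvd 1 one_lt_two
  rw [map_sub, coeff_expSeries, PowerSeries.coeff_one] at hcoeff
  exact hd.ne' (by simpa using hcoeff)

theorem cyclotomic_pow_dvd_of_X_pow_dvd {ζ : ℂ} {d : ℕ} (hd : 0 < d) (hζ : IsPrimitiveRoot ζ d)
    {e : ℕ} {P : ℚ[X]} (h : PowerSeries.X ^ e ∣ aeval (deformedRoot ζ) P) :
    cyclotomic d ℚ ^ e ∣ P := by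
  induction e generalizing P with
  | zero => simp
  | succ e ih =>
    obtain ⟨P, rfl⟩ := (X_dvd_aeval_deformedRoot_iff hd hζ).mp
      ((dvd_pow_self _ e.succ_ne_zero).trans h)
    obtain ⟨g, hg⟩ := (X_dvd_aeval_deformedRoot_iff hd hζ).mpr (dvd_refl (cyclotomic d ℚ))
    have hg' : ¬ PowerSeries.X ∣ g := fun hdvd => not_X_sq_dvd_aeval_cyclotomic hd hζ
      (by rw [hg, sq]; exact mul_dvd_mul_left _ hdvd)
    rw [map_mul, hg, pow_succ', mul_assoc, mul_dvd_mul_iff_left PowerSeries.X_ne_zero] at h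
    rw [pow_succ']
    exact mul_dvd_mul_left _ (ih (PowerSeries.X_prime.pow_dvd_of_dvd_mul_left e hg' h))

section Numerator

variable {K : Type*} [Field K] {P : K[X]} {f g : RatFunc K}

theorem num_mul_eq_mul_denom {N D : K[X]} (hD : D ≠ 0)
    (h : f * algebraMap K[X] (RatFunc K) D = algebraMap K[X] (RatFunc K) N) :
    f.num * D = N * f.denom :=
  (RatFunc.num_mul_eq_mul_denom_iff hD).mpr
    (eq_div_of_mul_eq (RatFunc.algebraMap_ne_zero hD) h)

theorem dvd_num_of_mul_eq {N D : K[X]} (hD : D ≠ 0) (hPD : IsCoprime P D) (hN : P ∣ N)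
    (h : f * algebraMap K[X] (RatFunc K) D = algebraMap K[X] (RatFunc K) N) : P ∣ f.num :=
  hPD.dvd_of_dvd_mul_right (num_mul_eq_mul_denom hD h ▸ hN.mul_right _)

theorem dvd_num_add (hf : P ∣ f.num) (hg : P ∣ g.num) : P ∣ (f + g).num := by
  have hcoprime : IsCoprime P (f.denom * g.denom) :=
    (f.isCoprime_num_denom.of_isCoprime_of_dvd_left hf).mul_right
      (g.isCoprime_num_denom.of_isCoprime_of_dvd_left hg)
  refine hcoprime.dvd_of_dvd_mul_right ?_
  rw [RatFunc.num_denom_add]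
  exact (dvd_add (hf.mul_right _) (hg.mul_left _)).mul_right _

theorem dvd_num_sum {ι : Type*} {s : Finset ι} {f : ι → RatFunc K} (h : ∀ i ∈ s, P ∣ (f i).num) :
    P ∣ (∑ i ∈ s, f i).num :=
  sum_induction f (P ∣ ·.num) (fun _ _ => dvd_num_add) (by simp) h

end Numerator

section Value

variable {K L : Type*} [Field K] [Field L] [Algebra K L]

/-- The graph of evaluation at `ζ`: the pairs `(f, v)` of a rational function `f` regular at `ζ`
and its value `v`. As a subring it gives sums, products and powers of values. -/
def evalGraph (ζ : L) : Subring (RatFunc K × L) where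
  carrier := {p | ∃ N D : K[X], aeval ζ D ≠ 0 ∧
    p.1 * algebraMap K[X] (RatFunc K) D = algebraMap K[X] (RatFunc K) N ∧
    p.2 * aeval ζ D = aeval ζ N}
  mul_mem' := by
    rintro ⟨f, v⟩ ⟨g, w⟩ ⟨N, D, hD, hf, hv⟩ ⟨N', D', hD', hg, hw⟩
    refine ⟨N * N', D * D', by rw [map_mul]; exact mul_ne_zero hD hD', ?_, ?_⟩
    · simp only [Prod.mk_mul_mk, map_mul, ← hf, ← hg]
      ring
    · simp only [Prod.mk_mul_mk, map_mul, ← hv, ← hw]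
      ring
  add_mem' := by
    rintro ⟨f, v⟩ ⟨g, w⟩ ⟨N, D, hD, hf, hv⟩ ⟨N', D', hD', hg, hw⟩
    refine ⟨N * D' + N' * D, D * D', by rw [map_mul]; exact mul_ne_zero hD hD', ?_, ?_⟩
    · simp only [Prod.mk_add_mk, map_add, map_mul, ← hf, ← hg]
      ring
    · simp only [Prod.mk_add_mk, map_add, map_mul, ← hv, ← hw]
      ring
  neg_mem' := by
    rintro ⟨f, v⟩ ⟨N, D, hD, hf, hv⟩
    exact ⟨-N, D, hD, by simp [← hf], by simp [← hv]⟩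
  one_mem' := ⟨1, 1, by simp⟩
  zero_mem' := ⟨0, 1, by simp⟩

/-- The rational function `f` is regular at `ζ`, with value `v`. -/
def HasValue (ζ : L) (f : RatFunc K) (v : L) : Prop := (f, v) ∈ evalGraph ζ

namespace HasValue

variable {ζ : L} {f g : RatFunc K} {v v' : L}

theorem of_polynomial (ζ : L) (P : K[X]) :
    HasValue ζ (algebraMap K[X] (RatFunc K) P) (aeval ζ P) :=
  ⟨P, 1, by simp⟩

theorem X_pow (ζ : L) (k : ℕ) : HasValue (K := K) ζ (RatFunc.X ^ k) (ζ ^ k) := by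
  simpa using of_polynomial (K := K) ζ (X ^ k)

theorem one : HasValue (K := K) ζ 1 1 := one_mem (evalGraph ζ)

theorem mul (hf : HasValue ζ f v) (hg : HasValue ζ g v') : HasValue ζ (f * g) (v * v') :=
  mul_mem (S := Subring (RatFunc K × L)) hf hg

theorem add (hf : HasValue ζ f v) (hg : HasValue ζ g v') : HasValue ζ (f + g) (v + v') :=
  add_mem (S := Subring (RatFunc K × L)) hf hg

theorem sub (hf : HasValue ζ f v) (hg : HasValue ζ g v') : HasValue ζ (f - g) (v - v') :=
  sub_mem (H := evalGraph ζ) hf hg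

theorem pow (hf : HasValue ζ f v) (k : ℕ) : HasValue ζ (f ^ k) (v ^ k) :=
  pow_mem (S := evalGraph ζ) hf k

theorem sum {ι : Type*} {s : Finset ι} {f : ι → RatFunc K} {v : ι → L}
    (h : ∀ i ∈ s, HasValue ζ (f i) (v i)) : HasValue ζ (∑ i ∈ s, f i) (∑ i ∈ s, v i) := by
  rw [HasValue, prod_mk_sum]
  exact sum_mem h

theorem inv (hf : HasValue ζ f v) (hv : v ≠ 0) : HasValue ζ f⁻¹ v⁻¹ := by
  obtain ⟨N, D, hD, hND, hvalue⟩ := hf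
  have hN : aeval ζ N ≠ 0 := hvalue ▸ mul_ne_zero hv hD
  have hf0 : f ≠ 0 := by
    rintro rfl
    rw [zero_mul, eq_comm, map_eq_zero_iff _ (RatFunc.algebraMap_injective K)] at hND
    exact hN (by rw [hND, map_zero])
  exact ⟨D, N, hN, by rw [← hND, inv_mul_cancel_left₀ hf0],
    by rw [← hvalue, inv_mul_cancel_left₀ hv]⟩

theorem div (hf : HasValue ζ f v) (hg : HasValue ζ g v') (hv : v' ≠ 0) :
    HasValue ζ (f / g) (v / v') := by
  rw [div_eq_mul_inv, div_eq_mul_inv]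
  exact hf.mul (hg.inv hv)

theorem minpoly_dvd_num (hf : HasValue ζ f 0) : minpoly K ζ ∣ f.num := by
  obtain ⟨N, D, hD, hND, hvalue⟩ := hf
  have hD0 : D ≠ 0 := fun h => hD (by rw [h, map_zero])
  have h := congrArg (aeval ζ) (num_mul_eq_mul_denom hD0 hND)
  rw [map_mul, map_mul, ← hvalue, zero_mul, zero_mul] at h
  exact minpoly.dvd K ζ ((mul_eq_zero.mp h).resolve_right hD)

end HasValue

end Value

end LocalDivisibility

section Blocks

theorem qShifted_eq_qShiftedCube {F : Type*} [Field F] (q : F) (c k : ℕ) :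
    qShifted (q ^ c) (q ^ 3) k = qShiftedCube q c 1 k := by
  simp only [qShifted, qShiftedCube, ← pow_mul, ← pow_add, add_comm c, mul_one]

theorem one_sub_pow_dvd_qShiftedCube {A : Type*} [CommRing A] (q : A) {d r i m : ℕ} (hi : i < m)
    (hd : d ∣ 3 * i + r) : 1 - q ^ d ∣ qShiftedCube q r 1 m := by
  obtain ⟨e, he⟩ := hd
  refine Dvd.dvd.trans ?_ (dvd_prod_of_mem _ (mem_range.mpr hi))
  rw [mul_one, he, pow_mul]
  exact one_sub_dvd_one_sub_pow _ _

theorem qShiftedCube_eq_zero {A : Type*} [CommRing A] {q : A} {d r i m : ℕ} (hq : q ^ d = 1)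
    (hi : i < m) (hd : d ∣ 3 * i + r) : qShiftedCube q r 1 m = 0 := by
  simpa only [hq, sub_self, zero_dvd_iff] using one_sub_pow_dvd_qShiftedCube q hi hd

theorem qShiftedCube_period {A : Type*} [CommRing A] {q : A} {d : ℕ} (hq : q ^ d = 1)
    (a r : ℕ) (z : A) (m : ℕ) : qShiftedCube q (3 * (d * a) + r) z m = qShiftedCube q r z m := by
  have hpow (i : ℕ) : q ^ (3 * i + (3 * (d * a) + r)) = q ^ (3 * i + r) := by
    rw [show 3 * i + (3 * (d * a) + r) = d * (3 * a) + (3 * i + r) by ring, pow_add, pow_mul, hq,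
      one_pow, one_mul]
  simp only [qShiftedCube, hpow]

/-- The quotient `(q ^ c; q ^ 3)_k / (q ^ 3; q ^ 3)_k`. -/
def shiftedQuotient {F : Type*} [Field F] (q : F) (c k : ℕ) : F :=
  qShiftedCube q c 1 k / qShiftedCube q 3 1 k

theorem shiftedQuotient_add {F : Type*} [Field F] (q : F) (c k l : ℕ) :
    shiftedQuotient q c (k + l) = shiftedQuotient q c k *
      (qShiftedCube q (3 * k + c) 1 l / qShiftedCube q (3 * k + 3) 1 l) := by
  rw [shiftedQuotient, qShiftedCube_add, qShiftedCube_add, mul_div_mul_comm, shiftedQuotient]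

/-- The `k`-th term of the truncated series. -/
def seriesTerm {F : Type*} [Field F] (q : F) (k : ℕ) : F :=
  qInteger q (6 * k + 1) * shiftedQuotient q 1 k ^ 6 * q ^ (3 * k)

theorem mul_sum_seriesTerm {F : Type*} [Field F] {q : F} (hq : q ≠ 1) {m : ℕ}
    (hm : qShiftedCube q 3 1 m ≠ 0) :
    (1 - q) * qShiftedCube q 3 1 m ^ 6 * ∑ k ∈ range (m + 1), seriesTerm q k =
      clearedSum q 1 1 m := by
  rw [clearedSum, Nat.sum_antidiagonal_eq_sum_range_succ_mk, mul_sum]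
  refine sum_congr rfl fun k hk => ?_
  have hk : k ≤ m := Nat.lt_succ_iff.mp (mem_range.mp hk)
  have hsplit := qShiftedCube_add q 3 1 k (m - k)
  rw [Nat.add_sub_cancel' hk] at hsplit
  have hk0 : qShiftedCube q 3 1 k ≠ 0 := left_ne_zero_of_mul (hsplit ▸ hm)
  have hq' : 1 - q ≠ 0 := sub_ne_zero.mpr hq.symm
  simp only [Pi.one_apply, prod_const, card_univ, Fintype.card_fin]
  rw [seriesTerm, shiftedQuotient, qInteger, hsplit]
  field_simp

section RootOfUnity

variable {L : Type*} [Field L] {ζ : L} {d l : ℕ}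

theorem qShiftedCube_three_ne_zero (hζ : IsPrimitiveRoot ζ d) (hd3 : d.Coprime 3) (hl : l < d) :
    qShiftedCube ζ 3 1 l ≠ 0 := by
  refine prod_ne_zero_iff.mpr fun i hi => ?_
  rw [mul_one]
  refine sub_ne_zero.mpr fun h => ?_
  have hdvd : d ∣ 3 * (i + 1) := hζ.dvd_of_pow_eq_one _ h.symm
  have hle := Nat.le_of_dvd i.succ_pos (hd3.dvd_of_dvd_mul_left hdvd)
  have := mem_range.mp hi
  lia

theorem seriesTerm_eq_zero (hζ : IsPrimitiveRoot ζ d) {k : ℕ} (hl : d ∣ 3 * l + 1) (hk : l < k) :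
    seriesTerm ζ k = 0 := by
  simp [seriesTerm, shiftedQuotient, qShiftedCube_eq_zero hζ.pow_eq_one hk hl]

variable [CharZero L]

theorem sum_seriesTerm_eq_zero (hζ : IsPrimitiveRoot ζ d) (hd : 1 < d) (hd3 : d.Coprime 3)
    (hld : l < d) (hl : d ∣ 3 * l + 1) : ∑ k ∈ range (l + 1), seriesTerm ζ k = 0 := by
  have hζ1 := hζ.ne_one hd
  have h3 := qShiftedCube_three_ne_zero hζ hd3 hld
  have h := mul_sum_seriesTerm hζ1 h3
  rw [clearedSum_eq_zero ((hζ.pow_eq_one_iff_dvd _).mpr hl) (by simp) (by simp)] at h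
  exact (mul_eq_zero.mp h).resolve_left
    (mul_ne_zero (sub_ne_zero.mpr hζ1.symm) (pow_ne_zero _ h3))

theorem sum_block_seriesTerm_eq_zero (hζ : IsPrimitiveRoot ζ d) (hd : 1 < d) (hd3 : d.Coprime 3)
    (hld : l < d) (hl : d ∣ 3 * l + 1) : ∑ k ∈ range d, seriesTerm ζ k = 0 := by
  rw [← sum_range_add_sum_Ico _ (Nat.succ_le_of_lt hld),
    sum_seriesTerm_eq_zero hζ hd hd3 hld hl, zero_add]
  exact sum_eq_zero fun k hk => seriesTerm_eq_zero hζ hl (mem_Ico.mp hk).1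

end RootOfUnity

theorem X_pow_ne_one {K : Type*} [Field K] {d : ℕ} (hd : 0 < d) :
    (RatFunc.X : RatFunc K) ^ d ≠ 1 := by
  rw [← RatFunc.algebraMap_X, ← map_pow, Ne, map_eq_one_iff _ (RatFunc.algebraMap_injective K)]
  exact fun h => Polynomial.X_pow_sub_C_ne_zero hd (1 : K) (by rw [h, map_one, sub_self])

variable {K L : Type*} [Field K] [Field L] [Algebra K L] {ζ : L} {d : ℕ}

theorem aeval_qShiftedCube {A : Type*} [CommRing A] [Algebra K A] (q : A) (r m : ℕ) :
    Polynomial.aeval q (qShiftedCube (Polynomial.X : Polynomial K) r 1 m) =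
      qShiftedCube q r 1 m := by
  simp [qShiftedCube]

theorem aeval_clearedSum_one {A : Type*} [CommRing A] [Algebra K A] (q : A) (m : ℕ) :
    Polynomial.aeval q (clearedSum (Polynomial.X : Polynomial K) 1 1 m) = clearedSum q 1 1 m := by
  simp [clearedSum, aeval_qShiftedCube]

theorem hasValue_qShiftedCube (ζ : L) (r m : ℕ) :
    HasValue (K := K) ζ (qShiftedCube RatFunc.X r 1 m) (qShiftedCube ζ r 1 m) := by
  have h := HasValue.of_polynomial (K := K) ζ (qShiftedCube Polynomial.X r 1 m)
  rwa [map_qShiftedCube, RatFunc.algebraMap_X, map_one, aeval_qShiftedCube] at h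

theorem hasValue_one_sub_X_pow (ζ : L) (r : ℕ) :
    HasValue (K := K) ζ (1 - RatFunc.X ^ r) (1 - ζ ^ r) :=
  .sub .one (.X_pow ζ r)

theorem hasValue_qInteger (hζ : ζ ≠ 1) (r : ℕ) :
    HasValue (K := K) ζ (qInteger RatFunc.X r) (qInteger ζ r) :=
  (hasValue_one_sub_X_pow ζ r).div (by simpa using hasValue_one_sub_X_pow ζ 1)
    (sub_ne_zero.mpr hζ.symm)

theorem hasValue_shiftedQuotient_add (hζ : IsPrimitiveRoot ζ d) (hd3 : d.Coprime 3) {c j l : ℕ}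
    (hl : l < d) {v : L} (hv : HasValue (K := K) ζ (shiftedQuotient RatFunc.X c (d * j)) v) :
    HasValue ζ (shiftedQuotient (RatFunc.X : RatFunc K) c (d * j + l))
      (v * shiftedQuotient ζ c l) := by
  have hperiod := qShiftedCube_period hζ.pow_eq_one j
  have h := (hasValue_qShiftedCube (K := K) ζ (3 * (d * j) + c) l).div
    (hasValue_qShiftedCube ζ (3 * (d * j) + 3) l)
    (by rw [hperiod]; exact qShiftedCube_three_ne_zero hζ hd3 hl)
  rw [hperiod, hperiod] at h
  rw [shiftedQuotient_add]
  exact hv.mul h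

theorem hasValue_seriesTerm_add (hζ : IsPrimitiveRoot ζ d) (hd : 1 < d) (hd3 : d.Coprime 3)
    {j l : ℕ} (hl : l < d) {v : L}
    (hv : HasValue (K := K) ζ (shiftedQuotient RatFunc.X 1 (d * j)) v) :
    HasValue ζ (seriesTerm (RatFunc.X : RatFunc K) (d * j + l)) (v ^ 6 * seriesTerm ζ l) := by
  have hperiod (a b : ℕ) : ζ ^ (d * a + b) = ζ ^ b := by
    rw [pow_add, pow_mul, hζ.pow_eq_one, one_pow, one_mul]
  have h := ((hasValue_qInteger (hζ.ne_one hd) (6 * (d * j + l) + 1)).mul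
    ((hasValue_shiftedQuotient_add hζ hd3 hl hv).pow 6)).mul (.X_pow ζ (3 * (d * j + l)))
  convert! h using 1
  rw [seriesTerm, qInteger, qInteger,
    show 6 * (d * j + l) + 1 = d * (6 * j) + (6 * l + 1) by ring,
    show 3 * (d * j + l) = d * (3 * j) + 3 * l by ring, hperiod, hperiod]
  ring

variable [CharZero L]

/-- The factors of a block that vanish at `ζ` are divisible by `1 - q ^ d`, and there is exactly
one of them in the denominator. -/
theorem exists_hasValue_block (hζ : IsPrimitiveRoot ζ d) (hd3 : d.Coprime 3) {r i : ℕ}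
    (hi : i < d) (hr : d ∣ 3 * i + r) (j : ℕ) :
    ∃ v, HasValue (K := K) ζ (qShiftedCube RatFunc.X r 1 d /
      qShiftedCube RatFunc.X (3 * (d * j) + 3) 1 d) v := by
  obtain ⟨N, hN⟩ := one_sub_pow_dvd_qShiftedCube (Polynomial.X : Polynomial K) hi hr
  have hN' := congrArg (algebraMap _ (RatFunc K)) hN
  rw [map_qShiftedCube, map_mul, map_sub, map_pow, map_one, RatFunc.algebraMap_X] at hN'
  have hX : (1 : RatFunc K) - RatFunc.X ^ d ≠ 0 :=
    sub_ne_zero.mpr (X_pow_ne_one (Nat.zero_lt_of_lt hi)).symm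
  have hgeom : HasValue (K := K) ζ (∑ i ∈ range (3 * j + 3), (RatFunc.X ^ d) ^ i)
      ((3 * j + 3 : ℕ) : L) := by
    have h := HasValue.sum (K := K) (s := range (3 * j + 3)) fun i _ => (HasValue.X_pow ζ d).pow i
    simpa [hζ.pow_eq_one] using h
  obtain ⟨e, rfl⟩ : ∃ e, d = e + 1 := ⟨d - 1, by lia⟩
  have hdenom : qShiftedCube (RatFunc.X : RatFunc K) (3 * ((e + 1) * j) + 3) 1 (e + 1) =
      (1 - RatFunc.X ^ (e + 1)) * (qShiftedCube RatFunc.X (3 * ((e + 1) * j) + 3) 1 e *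
        ∑ i ∈ range (3 * j + 3), (RatFunc.X ^ (e + 1)) ^ i) := by
    rw [qShiftedCube, prod_range_succ, ← qShiftedCube, mul_one,
      show 3 * e + (3 * ((e + 1) * j) + 3) = (e + 1) * (3 * j + 3) by ring, pow_mul,
      ← mul_neg_geom_sum]
    ring
  rw [hN', hdenom, mul_div_mul_left _ _ hX]
  refine ⟨_, (HasValue.of_polynomial ζ N).div ((hasValue_qShiftedCube ζ _ e).mul hgeom) ?_⟩
  rw [qShiftedCube_period hζ.pow_eq_one]
  exact mul_ne_zero (qShiftedCube_three_ne_zero hζ hd3 e.lt_succ_self)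
    (Nat.cast_ne_zero.mpr (Nat.succ_ne_zero _))

theorem exists_hasValue_shiftedQuotient_mul (hζ : IsPrimitiveRoot ζ d) (hd3 : d.Coprime 3)
    {c i : ℕ} (hi : i < d) (hc : d ∣ 3 * i + c) (j : ℕ) :
    ∃ v, HasValue (K := K) ζ (shiftedQuotient RatFunc.X c (d * j)) v := by
  induction j with
  | zero => exact ⟨1, by simpa [shiftedQuotient, qShiftedCube] using HasValue.one⟩
  | succ j ih =>
    obtain ⟨v, hv⟩ := ih
    obtain ⟨w, hw⟩ := exists_hasValue_block (K := K) hζ hd3 (r := 3 * (d * j) + c) hi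
      (by simpa [add_left_comm] using ((Dvd.intro j rfl).mul_left 3).add hc) j
    exact ⟨v * w, by rw [mul_add_one, shiftedQuotient_add]; exact hv.mul hw⟩

theorem hasValue_sum_block (hζ : IsPrimitiveRoot ζ d) (hd : 1 < d) (hd3 : d.Coprime 3) {l : ℕ}
    (hld : l < d) (hl : d ∣ 3 * l + 1) (j : ℕ) {m : ℕ} (hm : m ≤ d)
    (hsum : ∑ k ∈ range m, seriesTerm ζ k = 0) :
    HasValue (K := K) ζ (∑ k ∈ range m, seriesTerm RatFunc.X (d * j + k)) 0 := by
  obtain ⟨v, hv⟩ := exists_hasValue_shiftedQuotient_mul (K := K) hζ hd3 hld hl j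
  have h := HasValue.sum fun k (hk : k ∈ range m) =>
    hasValue_seriesTerm_add hζ hd hd3 ((mem_range.mp hk).trans_le hm) hv
  rwa [← mul_sum, hsum, mul_zero] at h

theorem hasValue_sum_seriesTerm (hζ : IsPrimitiveRoot ζ d) (hd : 1 < d) (hd3 : d.Coprime 3)
    {l : ℕ} (hld : l < d) (hl : d ∣ 3 * l + 1) (j : ℕ) {m : ℕ} (hm : m ≤ d)
    (hsum : ∑ k ∈ range m, seriesTerm ζ k = 0) :
    HasValue (K := K) ζ (∑ k ∈ range (d * j + m), seriesTerm RatFunc.X k) 0 := by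
  have hblocks : HasValue (K := K) ζ (∑ k ∈ range (d * j), seriesTerm RatFunc.X k) 0 := by
    induction j with
    | zero => simpa using HasValue.of_polynomial (K := K) ζ 0
    | succ j ih =>
      have hblock := hasValue_sum_block (K := K) hζ hd hd3 hld hl j le_rfl
        (sum_block_seriesTerm_eq_zero hζ hd hd3 hld hl)
      simpa only [mul_add_one, sum_range_add, add_zero] using ih.add hblock
  rw [sum_range_add]
  simpa only [add_zero] using hblocks.add (hasValue_sum_block hζ hd hd3 hld hl j hm hsum)

end Blocks

section Supercongruence

open Polynomial

theorem isCoprime_cyclotomic {ζ : ℂ} {d : ℕ} (hd : 0 < d) (hζ : IsPrimitiveRoot ζ d) {D : ℚ[X]}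
    (hD : aeval ζ D ≠ 0) : IsCoprime (cyclotomic d ℚ) D := by
  rw [(cyclotomic.irreducible_rat hd).coprime_iff_not_dvd, cyclotomic_eq_minpoly_rat hζ hd,
    minpoly.dvd_iff]
  exact hD

theorem isCoprime_cyclotomic_denom {n m : ℕ} (hn : 1 < n) (hn3 : n.Coprime 3) (hm : m < n) :
    IsCoprime (cyclotomic n ℚ) ((1 - X) * qShiftedCube X 3 1 m ^ 6) := by
  have hζ := Complex.isPrimitiveRoot_exp n (Nat.ne_zero_of_lt hn)
  refine isCoprime_cyclotomic (Nat.zero_lt_of_lt hn) hζ ?_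
  rw [map_mul, map_sub, map_one, aeval_X, map_pow, aeval_qShiftedCube]
  exact mul_ne_zero (sub_ne_zero.mpr (hζ.ne_one hn).symm)
    (pow_ne_zero _ (qShiftedCube_three_ne_zero hζ hn3 hm))

theorem dvd_num_of_mul_denom_eq {n m e : ℕ} (hn : 1 < n) (hn3 : n.Coprime 3) (hm : m < n)
    {f : RatFunc ℚ} {N : ℚ[X]} (hN : cyclotomic n ℚ ^ e ∣ N)
    (h : f * ((1 - RatFunc.X) * qShiftedCube RatFunc.X 3 1 m ^ 6) = algebraMap ℚ[X] _ N) :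
    cyclotomic n ℚ ^ e ∣ f.num := by
  have hcoprime := isCoprime_cyclotomic_denom hn hn3 hm
  refine dvd_num_of_mul_eq (fun hD => ?_) hcoprime.pow_left hN
    (by simpa only [map_mul, map_sub, map_one, map_pow, map_qShiftedCube, RatFunc.algebraMap_X])
  rw [hD, isCoprime_zero_right] at hcoprime
  exact (cyclotomic.irreducible_rat (Nat.zero_lt_of_lt hn)).not_isUnit hcoprime

theorem one_sub_ratFuncX_ne_zero : (1 : RatFunc ℚ) - RatFunc.X ≠ 0 :=
  sub_ne_zero.mpr (by simpa using (X_pow_ne_one (K := ℚ) one_pos).symm)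

theorem qShiftedCube_three_ratFuncX_ne_zero (m : ℕ) :
    qShiftedCube (RatFunc.X : RatFunc ℚ) 3 1 m ≠ 0 :=
  prod_ne_zero_iff.mpr fun i _ => by
    simpa only [mul_one] using sub_ne_zero.mpr (X_pow_ne_one (by lia : 0 < 3 * i + 3)).symm

/-- The right-hand side of the congruence, for `n = 3 t + 2`. -/
def closedForm {F : Type*} [Field F] (q : F) (t : ℕ) : F :=
  5 * qInteger q (2 * (3 * t + 2)) * shiftedQuotient q 2 (2 * t + 1) ^ 3

variable {t d : ℕ}

theorem coprime_three_of_dvd (hd : d ∣ 3 * t + 2) : d.Coprime 3 := by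
  refine Nat.Coprime.coprime_dvd_left hd ?_
  rw [Nat.coprime_comm, Nat.coprime_mul_left_add_right]
  decide

theorem cyclotomic_pow_six_dvd_num_sub_closedForm (t : ℕ) :
    cyclotomic (3 * t + 2) ℚ ^ 6 ∣
      (∑ k ∈ range (2 * t + 1 + 1), seriesTerm RatFunc.X k - closedForm RatFunc.X t).num := by
  set n := 3 * t + 2 with hn
  set m := 2 * t + 1 with hm
  have hζ := Complex.isPrimitiveRoot_exp n (by lia)
  refine dvd_num_of_mul_denom_eq (by lia) (coprime_three_of_dvd (dvd_refl n)) (by lia : m < n)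
    (N := clearedSum X 1 1 m -
      5 * (1 - X ^ (2 * n)) * qShiftedCube X 2 1 m ^ 3 * qShiftedCube X 3 1 m ^ 3) ?_ ?_
  · refine cyclotomic_pow_dvd_of_X_pow_dvd (by lia) hζ ?_
    simpa only [map_sub, map_mul, map_pow, map_one, map_ofNat, aeval_X, aeval_clearedSum_one,
      aeval_qShiftedCube] using X_pow_six_dvd_clearedSum_sub hm hn hζ
  · have hX := one_sub_ratFuncX_ne_zero
    have h3 := qShiftedCube_three_ratFuncX_ne_zero m
    have hsum := mul_sum_seriesTerm (sub_ne_zero.mp hX).symm h3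
    have hclosed : closedForm RatFunc.X t * ((1 - RatFunc.X) * qShiftedCube RatFunc.X 3 1 m ^ 6) =
        5 * (1 - RatFunc.X ^ (2 * n)) * qShiftedCube RatFunc.X 2 1 m ^ 3 *
          qShiftedCube (RatFunc.X : RatFunc ℚ) 3 1 m ^ 3 := by
      rw [closedForm, qInteger, shiftedQuotient, ← hm, ← hn]
      field_simp
    rw [sub_mul, hclosed, mul_comm, hsum]
    have hconst (φ : ℚ[X] →+* RatFunc ℚ) : φ ∘ (1 : Fin 6 → ℚ[X]) = 1 := funext fun _ => map_one φ
    simp only [map_sub, map_mul, map_pow, map_one, map_ofNat, map_clearedSum, map_qShiftedCube,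
      RatFunc.algebraMap_X, hconst]

theorem cyclotomic_pow_six_dvd_num_seriesTerm {k : ℕ} (htk : 2 * t + 1 < k) (hkn : k < 3 * t + 2) :
    cyclotomic (3 * t + 2) ℚ ^ 6 ∣ (seriesTerm RatFunc.X k).num := by
  have hdvd : cyclotomic (3 * t + 2) ℚ ∣ qShiftedCube X 1 1 k := by
    refine (cyclotomic.dvd_X_pow_sub_one _ ℚ).trans ((dvd_sub_comm.mp dvd_rfl).trans
      (one_sub_pow_dvd_qShiftedCube X htk ⟨2, by ring⟩))
  refine dvd_num_of_mul_denom_eq (by lia) (coprime_three_of_dvd dvd_rfl) hkn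
    (((pow_dvd_pow_of_dvd hdvd 6).mul_left (1 - X ^ (6 * k + 1))).mul_right (X ^ (3 * k))) ?_
  have hX := one_sub_ratFuncX_ne_zero
  have h3 := qShiftedCube_three_ratFuncX_ne_zero k
  simp only [map_mul, map_sub, map_one, map_pow, map_qShiftedCube, RatFunc.algebraMap_X]
  rw [seriesTerm, qInteger, shiftedQuotient]
  field_simp

theorem dvd_three_mul_mod_add {a r : ℕ} (h : d ∣ 3 * a + r) : d ∣ 3 * (a % d) + r := by
  rw [← Nat.modEq_zero_iff_dvd] at h ⊢
  exact (((Nat.mod_modEq a d).mul_left 3).add_right r).trans h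

theorem hasValue_closedForm {ζ : ℂ} (hζ : IsPrimitiveRoot ζ d) (hd1 : 1 < d) (hd : d ∣ 3 * t + 2) :
    HasValue (K := ℚ) ζ (closedForm RatFunc.X t) 0 := by
  have hd0 : 0 < d := Nat.zero_lt_of_lt hd1
  have hd3 := coprime_three_of_dvd hd
  obtain ⟨v, hv⟩ := exists_hasValue_shiftedQuotient_mul (K := ℚ) hζ hd3 (Nat.mod_lt t hd0)
    (dvd_three_mul_mod_add hd) ((2 * t + 1) / d)
  have hquotient := hasValue_shiftedQuotient_add hζ hd3 (Nat.mod_lt (2 * t + 1) hd0) hv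
  have hzero : qInteger ζ (2 * (3 * t + 2)) = 0 := by
    rw [qInteger, (hζ.pow_eq_one_iff_dvd _).mpr (hd.mul_left 2), sub_self, zero_div]
  have h := ((HasValue.of_polynomial ζ 5).mul
    (hasValue_qInteger (hζ.ne_one hd1) (2 * (3 * t + 2)))).mul (hquotient.pow 3)
  simpa only [closedForm, Nat.div_add_mod, hzero, mul_zero, zero_mul, map_ofNat] using h

theorem hasValue_truncatedSum {ζ : ℂ} (hζ : IsPrimitiveRoot ζ d) (hd1 : 1 < d)
    (hd : d ∣ 3 * t + 2) {M : ℕ} (hM : M = 2 * t + 1 ∨ M = 3 * t + 1) :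
    HasValue (K := ℚ) ζ (∑ k ∈ range (M + 1), seriesTerm RatFunc.X k) 0 := by
  have hd3 := coprime_three_of_dvd hd
  have hld : (2 * t + 1) % d < d := Nat.mod_lt _ (Nat.zero_lt_of_lt hd1)
  have hl : d ∣ 3 * ((2 * t + 1) % d) + 1 := by
    refine dvd_three_mul_mod_add ?_
    rw [show 3 * (2 * t + 1) + 1 = 2 * (3 * t + 2) by ring]
    exact hd.mul_left 2
  rcases hM with rfl | rfl
  · have h := hasValue_sum_seriesTerm (K := ℚ) hζ hd1 hd3 hld hl ((2 * t + 1) / d)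
      (Nat.succ_le_of_lt hld) (sum_seriesTerm_eq_zero hζ hd1 hd3 hld hl)
    rwa [Nat.succ_eq_add_one, ← add_assoc, Nat.div_add_mod] at h
  · obtain ⟨j, hj⟩ := hd
    have h := hasValue_sum_seriesTerm (K := ℚ) hζ hd1 hd3 hld hl j (Nat.zero_le d)
      (sum_range_zero _)
    rwa [add_zero, ← hj] at h

theorem cyclotomic_dvd_num_sub_closedForm {M : ℕ} (hM : M = 2 * t + 1 ∨ M = 3 * t + 1)
    (hd1 : 1 < d) (hd : d ∣ 3 * t + 2) : cyclotomic d ℚ ∣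
      (∑ k ∈ range (M + 1), seriesTerm RatFunc.X k - closedForm RatFunc.X t).num := by
  have hζ := Complex.isPrimitiveRoot_exp d (Nat.ne_zero_of_lt hd1)
  have h := (hasValue_truncatedSum hζ hd1 hd hM).sub (hasValue_closedForm hζ hd1 hd)
  rw [sub_zero] at h
  rw [cyclotomic_eq_minpoly_rat hζ (Nat.zero_lt_of_lt hd1)]
  exact h.minpoly_dvd_num

theorem qIntegerPoly_mul_cyclotomic_pow_dvd {n e : ℕ} (hn : 1 < n) {P : ℚ[X]}
    (hpow : cyclotomic n ℚ ^ (e + 1) ∣ P) (hdvd : ∀ d, 1 < d → d ∣ n → cyclotomic d ℚ ∣ P) :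
    qIntegerPoly n * cyclotomic n ℚ ^ e ∣ P := by
  have hmem : n ∈ n.divisors.erase 1 := by simp; lia
  rw [qIntegerPoly, ← prod_cyclotomic_eq_geom_sum (Nat.zero_lt_of_lt hn) ℚ,
    ← mul_prod_erase _ _ hmem, mul_right_comm, ← pow_succ']
  refine IsCoprime.mul_dvd ?_ hpow ?_
  · exact (IsCoprime.prod_right fun d hd =>
      cyclotomic.isCoprime_rat (ne_of_mem_erase hd).symm).pow_left
  · refine Finset.prod_dvd_of_coprime (fun a _ b _ hab => cyclotomic.isCoprime_rat hab)
      fun d hd => ?_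
    obtain ⟨-, hd1, hd⟩ : d ≠ n ∧ d ≠ 1 ∧ d ∈ n.divisors := by simpa only [mem_erase] using hd
    exact hdvd d (by have := Nat.pos_of_mem_divisors hd; lia) (Nat.dvd_of_mem_divisors hd)

end Supercongruence

theorem theorem1p3 (n : ℕ) (hn : n ≡ 2 [MOD 3]) (M : ℕ)
    (hM : M = (2 * n - 1) / 3 ∨ M = n - 1) (q : RatFunc ℚ) (hq : q = RatFunc.X) :
    QCongr (qIntegerPoly n * Polynomial.cyclotomic n ℚ ^ 5)
      (∑ k ∈ Finset.range (M + 1),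
        qInteger q (6 * k + 1) * (qShifted q (q ^ 3) k ^ 6 / qShifted (q ^ 3) (q ^ 3) k ^ 6)
          * q ^ (3 * k))
      (5 * qInteger q (2 * n) *
        (qShifted (q ^ 2) (q ^ 3) ((2 * n - 1) / 3) ^ 3 /
          qShifted (q ^ 3) (q ^ 3) ((2 * n - 1) / 3) ^ 3)) := by
  subst hq
  obtain ⟨t, rfl⟩ : ∃ t, n = 3 * t + 2 := ⟨n / 3, by have : n % 3 = 2 := hn; lia⟩
  rw [show (2 * (3 * t + 2) - 1) / 3 = 2 * t + 1 by lia] at hM ⊢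
  rw [show 3 * t + 2 - 1 = 3 * t + 1 by lia] at hM
  have hnum (k : ℕ) : qShifted (RatFunc.X : RatFunc ℚ) (RatFunc.X ^ 3) k =
      qShiftedCube RatFunc.X 1 1 k := by
    rw [← qShifted_eq_qShiftedCube, pow_one]
  simp only [← div_pow, hnum, qShifted_eq_qShiftedCube]
  refine qIntegerPoly_mul_cyclotomic_pow_dvd (by lia) ?_
    fun d hd1 hd => cyclotomic_dvd_num_sub_closedForm hM hd1 hd
  have hshort := cyclotomic_pow_six_dvd_num_sub_closedForm t
  rcases hM with rfl | rfl
  · exact hshort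
  · have hlong := dvd_num_add hshort (dvd_num_sum (s := Ico (2 * t + 1 + 1) (3 * t + 1 + 1))
      fun k hk => cyclotomic_pow_six_dvd_num_seriesTerm (mem_Ico.mp hk).1 (mem_Ico.mp hk).2)
    rwa [sub_add_eq_add_sub, sum_range_add_sum_Ico _ (by lia)] at hlong
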